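/- **Lemma (No over-estimation under $\rho^{\mathrm{EST}}$).** *System.* There are $U\ge 1$ secondary users and $C\ge U$ channels; time is slotted. Channel $i$ is free in slot $k$ ($W_i(k)=1$) or occupied ($W_i(k)=0$), where the $W_i(k)$ are independent and $W_i(k)$ is Bernoulli with mean $\mu_i$; the $\mu_i\in(0,1)$ are distinct. In each slot each user senses one channel, observes its availability, and transmits on it if it is free. A user has a collision in a slot if it transmits and another user transmits on the same channel. *Statistic.* After $t$ slots, let $T_{i,j}(t)$ be the number of slots in which user $j$ has sensed channel $i$ and $\bar X_{i,j}$ the mean of the observed values; put $g_j(i;t)=\bar X_{i,j}+\sqrt{2\log t/T_{i,j}(t)}$, and let $\sigma(b;g_j(t))$ be the channel with the $b$-th highest entry of $g_j(\cdot;t)$, equal entries being ordered by channel index. *Policy $\rho^{\mathrm{EST}}$ with horizon $n$ and thresholds $\xi(n;k)\in\mathbb R$, followed by every user $j$.* In slots $1,\dots,C$ the user senses each channel once, in an arbitrary fixed order of its own; no collisions are recorded. Initially the estimate is $\widehat U_j=1$ and the rank is $1$. In each slot $m=C+1,\dots,n$: 1. if a collision is on record for slot $m-1$, draw a new rank uniformly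 from $\{1,\dots,\widehat U_j\}$, otherwise keep the rank; 2. sense the channel $\sigma(\text{rank};g_j(m-1))$, transmit if it is free, and record whether there was a collision on it; 3. if the number $\Phi$ of recorded collisions on the channels $\sigma(b;g_j(m))$, $1\le b\le\widehat U_j$, satisfies $\Phi>\xi(n;\widehat U_j)$, then increase $\widehat U_j$ by $1$ and discard all recorded collisions, including that of slot $m$. All rank draws are independent of each other and of the availabilities. (How a rank larger than $C$ is read is irrelevant to the claim, since it can occur only after over-estimation.) *Claim.* Let $\widehat U_j^{\mathrm{EST}}(n)$ be the estimate of user $j$ after $n$ slots of the policy with horizon $n$. If $\xi(n;1)\ge 0$ for all $n$ and, for every $k>1$, $\xi(n;k)=\omega(\log n)$, that is, $\xi(n;k)/\log n\to\infty$ as $n\to\infty$, then the probability that no user over-estimates the number of users tends to one: $$\lim_{n\to\infty}\mathbb P\Bigl[\ \bigcap_{j=1}^U\bigl\{\widehat U_j^{\mathrm{EST}}(n)\le U\bigr\}\Bigr]=1 .$$ -/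

import Mathlib

open Filter Topology MeasureTheory ProbabilityTheory

noncomputable section

namespace CognitiveAccess

/-- The local memory of one secondary user at the end of a slot (`C` channels). -/
structure UserState (C : ℕ) where
  /-- `sensed i`: the number of slots in which the user has sensed channel `i`. -/
  sensed : Fin C → ℕ
  /-- `free i`: the sum of the sensed values (1 = free, 0 = occupied) of channel `i`. -/
  free : Fin C → ℕ
  /-- The current estimate of the number of users. -/
  estimate : ℕ
  /-- The current rank, in `{1, …, estimate}`. -/
  rank : ℕ
  /-- `collisions i`: the number of recorded, not yet discarded collisions on channel `i`. -/
  collisions : Fin C → ℕ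
  /-- Whether a collision is on record (not discarded) for the most recent slot. -/
  collided : Bool

/-- Memory before the first slot: nothing sensed, no collisions, estimate 1 and rank 1. -/
def UserState.start (C : ℕ) : UserState C where
  sensed := fun _ => 0
  free := fun _ => 0
  estimate := 1
  rank := 1
  collisions := fun _ => 0
  collided := false

/-- `σ(b; g)`, zero-based: `sigma g b` is the index of the `(b+1)`-st highest entry of `g`.
Equal entries are ordered by their index. -/
def sigma {C : ℕ} (g : Fin C → ℝ) : Fin C → Fin C :=
  Tuple.sort (fun i => -g i)

namespace UserState

variable {C : ℕ}

/-- The sample-mean statistic of channel `i` after `t` slots: sample mean plus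
`√(2 log t / T_i)`. -/
def gMean (s : UserState C) (t : ℕ) (i : Fin C) : ℝ :=
  (s.free i : ℝ) / (s.sensed i : ℝ) + Real.sqrt (2 * Real.log t / (s.sensed i : ℝ))

/-- The collision count `Φ_k` after `t` slots: recorded collisions on the `k` channels with the
highest statistics. -/
def collisionCount (s : UserState C) (t k : ℕ) : ℕ :=
  ∑ b : Fin C with b.val < k, s.collisions (sigma (s.gMean t) b)

/-- Record the sensed value `w` of channel `i`. -/
def recordSense (s : UserState C) (i : Fin C) (w : ℕ) : UserState C :=
  { s with
    sensed := Function.update s.sensed i (s.sensed i + 1)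
    free := Function.update s.free i (s.free i + w) }

/-- Draw a new rank if the previous slot had a collision; `d u` is the outcome of a uniform draw
from `{1, …, u}`. -/
def redraw (s : UserState C) (d : ℕ → ℕ) : UserState C :=
  { s with rank := if s.collided then d s.estimate else s.rank }

/-- The channel of the current rank, by the statistics after `t` slots. (A rank above `C` can occur
only for an estimate above `C`; it is then read modulo `C`.) -/
def channel [NeZero C] (s : UserState C) (t : ℕ) : Fin C :=
  sigma (s.gMean t) (Fin.ofNat C (s.rank - 1))

/-- Record whether there was a collision (`c`) on the sensed channel `i` in the present slot. -/
def recordCollision (s : UserState C) (i : Fin C) (c : Bool) : UserState C :=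
  { s with
    collisions := Function.update s.collisions i (s.collisions i + if c then 1 else 0)
    collided := c }

/-- The test at the end of slot `t` against the thresholds `ξ`: if the collision count in the top
`estimate` channels exceeds `ξ estimate`, increment the estimate and discard all collisions. -/
def testEstimate (s : UserState C) (ξ : ℕ → ℝ) (t : ℕ) : UserState C :=
  if ξ s.estimate < (s.collisionCount t s.estimate : ℝ) then
    { s with
      estimate := s.estimate + 1
      collisions := fun _ => 0
      collided := false }
  else s

end UserState

variable {U C : ℕ}

/-- An initialization slot, in which user `j` senses channel `c j`. -/
def initSlot (S : Fin U → UserState C) (c : Fin U → Fin C) (w : Fin C → ℕ) :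
    Fin U → UserState C :=
  fun j => (S j).recordSense (c j) (w (c j))

/-- Slot `t + 1` of the main loop. `w i` is the availability of channel `i` in this slot and
`d j u` is the draw of user `j` from `{1, …, u}`. A user transmits iff the channel it
senses is free; a collision happens iff another user transmits on the same channel. -/
def loopSlot [NeZero C] (ξ : ℕ → ℝ) (t : ℕ) (S : Fin U → UserState C) (w : Fin C → ℕ)
    (d : Fin U → ℕ → ℕ) : Fin U → UserState C :=
  let R : Fin U → UserState C := fun j => (S j).redraw (d j)
  let c : Fin U → Fin C := fun j => (R j).channel t
  fun j =>
    (((R j).recordSense (c j) (w (c j))).recordCollision (c j)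
      (decide (w (c j) = 1 ∧ ∃ j' : Fin U, j' ≠ j ∧ c j' = c j))).testEstimate ξ (t + 1)

/-- The memories of all `U` users after `t` slots when all follow the policy `ρ^EST` with
thresholds `ξ` (those of the given horizon). In the slots `1, …, C` user `j` senses each channel
once, in the order `ord j`. `w i t` is the availability of channel `i` in slot `t`, and `d j t u`
is the draw of user `j` from `{1, …, u}` in slot `t`. -/
def run [NeZero C] (ξ : ℕ → ℝ) (ord : Fin U → Equiv.Perm (Fin C)) (w : Fin C → ℕ → ℕ)
    (d : Fin U → ℕ → ℕ → ℕ) : ℕ → Fin U → UserState C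
  | 0 => fun _ => UserState.start C
  | t + 1 =>
    let S := run ξ ord w d t
    if h : t < C then
      initSlot S (fun j => ord j ⟨t, h⟩) (fun i => w i (t + 1))
    else
      loopSlot ξ t S (fun i => w i (t + 1)) (fun j => d j (t + 1))

end CognitiveAccess

end

/-! A user over-estimates only by recording more than `ξ n U` collisions while its estimate is `U`.
For `U = 1` nobody ever collides. For `U ≥ 2`, Markov's inequality reduces the claim to an `O(log
n)` bound, uniform in the thresholds, on the expected number of slots in which a user of estimate
`U` can collide.

Disrupted slots (`Disrupted`) are few. Apart from boundedly many early ones, either the statistics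
are inaccurate, which has probability `O(1/t)` by an exponential supermartingale
(`measure_not_concentrated_le`), or a bounded count of observations and estimates increases
(`sum_broken_le`). In undisrupted slots before over-estimation each user senses one of the truly
best channels within its estimate (`position_channels_lt`), and a user without a collision stays on
its channel in the next one (`channels_succ`).

Since estimates may differ, a collision-free allocation need not be reachable: two users of estimate
1 share the best channel. The weaker notion `Frozen` suffices. It persists until a disruption
(`frozen_succ`) and, because `E < U`, protects users of estimate `U`. An extremal argument
(`frozen_of_maximal`) and finiteness give a frozen configuration within `M` steps of every valid one
(`exists_forall_near`). Given the past, each step is realized, unless disrupted, with probability at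
least `(∏ μ i) * U⁻¹ ^ U`: all channels are free and the right ranks are drawn. A Lyapunov function
of the distance to the frozen configurations (`energy_drift`, `lintegral_drift`) then bounds the
expected number of unsettled slots by a constant times one plus the expected number of disrupted
slots. -/

namespace CognitiveAccess

/-! ### Rankings of the channels by optimistic indices versus by true means -/

section Order

variable {C : ℕ}

lemma apply_sigma_le (g : Fin C → ℝ) {a b : Fin C} (h : a ≤ b) :
    g (sigma g b) ≤ g (sigma g a) := by
  have := Tuple.monotone_sort (fun i => -g i) h
  simpa [sigma] using this

/-- The permutation underlying `sigma`. -/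
noncomputable def sigmaPerm (g : Fin C → ℝ) : Equiv.Perm (Fin C) := Tuple.sort (fun i => -g i)

/-- The position of channel `i` in the descending order of `g`. -/
noncomputable def position (g : Fin C → ℝ) : Equiv.Perm (Fin C) := (sigmaPerm g).symm

@[simp] lemma position_sigma (g : Fin C → ℝ) (b : Fin C) : position g (sigma g b) = b :=
  (sigmaPerm g).symm_apply_apply b

@[simp] lemma sigma_position (g : Fin C → ℝ) (i : Fin C) : sigma g (position g i) = i :=
  (sigmaPerm g).apply_symm_apply i

lemma position_lt_of_lt {g : Fin C → ℝ} {x y : Fin C} (h : g y < g x) :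
    position g x < position g y := by
  by_contra! hle
  have := apply_sigma_le g hle
  simp only [sigma_position] at this
  linarith

lemma le_of_position_le {g : Fin C → ℝ} {x y : Fin C} (h : position g x ≤ position g y) :
    g y ≤ g x := by
  simpa using apply_sigma_le g h

lemma lt_of_position_lt {g : Fin C → ℝ} (hg : Function.Injective g) {x y : Fin C}
    (h : position g x < position g y) : g y < g x :=
  lt_of_le_of_ne (le_of_position_le h.le) fun he => by simp [hg he] at h

/-- A position is a number of predecessors, so an inclusion between sets of predecessors compares
positions. -/
lemma perm_apply_le_of_forall_lt {p q : Equiv.Perm (Fin C)} {s s' : Fin C}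
    (h : ∀ x, p x < p s → q x < q s') : p s ≤ q s' := by
  have : (Finset.Iio (p s)).map p.symm.toEmbedding ⊆
      (Finset.Iio (q s')).map q.symm.toEmbedding := by
    intro x hx
    simp only [Finset.mem_map_equiv, Equiv.symm_symm, Finset.mem_Iio] at hx ⊢
    exact h x hx
  have := Finset.card_le_card this
  simpa using this

lemma perm_apply_lt_of_forall_le {p q : Equiv.Perm (Fin C)} {s s' : Fin C}
    (h : ∀ x, p x ≤ p s → q x < q s') : p s < q s' := by
  have : (Finset.Iic (p s)).map p.symm.toEmbedding ⊆
      (Finset.Iio (q s')).map q.symm.toEmbedding := by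
    intro x hx
    simp only [Finset.mem_map_equiv, Equiv.symm_symm, Finset.mem_Iio, Finset.mem_Iic] at hx ⊢
    exact h x hx
  have := Finset.card_le_card this
  simp only [Finset.card_map, Fin.card_Iic, Fin.card_Iio] at this
  exact this

variable {μ : Fin C → ℝ} {Δ : ℝ}

lemma add_le_of_lt_of_gap (hgap : ∀ x y, x ≠ y → Δ ≤ |μ x - μ y|) {x y : Fin C}
    (h : μ x < μ y) : μ x + Δ ≤ μ y := by
  have := hgap y x (by rintro rfl; exact lt_irrefl _ h)
  rw [abs_of_pos (by linarith)] at this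
  linarith

lemma injective_of_gap (hΔ : 0 < Δ) (hgap : ∀ x y, x ≠ y → Δ ≤ |μ x - μ y|) :
    Function.Injective μ := by
  intro x y hxy
  by_contra hne
  have := hgap x y hne
  simp only [hxy, sub_self, abs_zero] at this
  linarith

/-- An optimistic index that is nearly exact at `s` does not place `s` too high. -/
lemma position_le_position (hΔ : 0 < Δ) (hgap : ∀ x y, x ≠ y → Δ ≤ |μ x - μ y|)
    {g : Fin C → ℝ} (hg : ∀ x, μ x ≤ g x) {s : Fin C} (hs : g s < μ s + Δ / 2) :
    position μ s ≤ position g s := by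
  refine perm_apply_le_of_forall_lt fun x hx => position_lt_of_lt ?_
  -- A truly better channel `x` has `g x ≥ μ x ≥ μ s + Δ > g s`, so optimism keeps it ahead of `s`.
  have := add_le_of_lt_of_gap hgap (lt_of_position_lt (injective_of_gap hΔ hgap) hx)
  linarith [hg x]

/-- If the top `e` entries of an optimistic index are nearly exact, then they comprise the `e` best
channels. -/
lemma position_lt_of_top (hΔ : 0 < Δ) (hgap : ∀ x y, x ≠ y → Δ ≤ |μ x - μ y|)
    {g : Fin C → ℝ} (hg : ∀ x, μ x ≤ g x) {e : ℕ}
    (hs : ∀ x, (position g x).val < e → g x < μ x + Δ / 2) {y : Fin C}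
    (hy : (position μ y).val < e) : (position g y).val < e := by
  by_contra! hlt
  have hC : e - 1 < C := by have := (position μ y).isLt; omega
  set z := sigma g ⟨e - 1, hC⟩ with hz
  have hpz : position g z = ⟨e - 1, hC⟩ := by simp [hz]
  -- If `y` is missing from the top `e`, each of the `e` channels up to `z` has `μ x + Δ / 2 > g x ≥
  -- g y ≥ μ y` and hence is truly better than `y`: too many for a channel among the `e` best.
  have : position g z < position μ y := by
    refine perm_apply_lt_of_forall_le fun x hx => position_lt_of_lt ?_
    have hx' : (position g x).val < e := by
      rw [hpz, Fin.le_def] at hx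
      simp only at hx
      omega
    have h1 := le_of_position_le (g := g) (x := x) (y := y) (by rw [Fin.le_def]; omega)
    have h2 := hs x hx'
    have hne : x ≠ y := by rintro rfl; omega
    by_contra! hle
    rcases hle.lt_or_eq with h | h
    · linarith [add_le_of_lt_of_gap hgap h, hg y]
    · exact hne (injective_of_gap hΔ hgap h)
  rw [hpz, Fin.lt_def] at this
  simp only at this
  omega

/-- If only channel `s`, in position `r`, has been sensed between the indices `g` and `g'`, then
another nearly exact channel does not take its position. -/
lemma sigma_eq_sigma (hΔ : 0 < Δ) (hgap : ∀ x y, x ≠ y → Δ ≤ |μ x - μ y|)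
    {g g' : Fin C → ℝ} (hg : ∀ x, μ x ≤ g x) (hg' : ∀ x, μ x ≤ g' x) {r : Fin C}
    (hs : g (sigma g r) < μ (sigma g r) + Δ / 2)
    (hs2 : g' (sigma g r) < μ (sigma g r) + Δ / 2)
    (hs' : g' (sigma g' r) < μ (sigma g' r) + Δ / 2)
    (hmono : ∀ x, x ≠ sigma g r → g x ≤ g' x)
    (hslow : ∀ x, x ≠ sigma g r → g' x ≤ g x + Δ / 2) :
    sigma g' r = sigma g r := by
  set s := sigma g r with hsdef
  set s' := sigma g' r with hsdef'
  have hps : position g s = r := by simp [hsdef]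
  have hps' : position g' s' = r := by simp [hsdef']
  by_contra hne
  rcases lt_trichotomy (μ s') (μ s) with h | h | h
  · have hgp := add_le_of_lt_of_gap hgap h
    -- If `s'` is worse than `s`, all that was weakly ahead of `s` under `g` still has index at
    -- least `μ s` and is strictly ahead of `s'` under `g'`.
    have : position g s < position g' s' := by
      refine perm_apply_lt_of_forall_le fun x hx => position_lt_of_lt ?_
      by_cases hxs : x = s
      · rw [hxs]; linarith [hg' s]
      · linarith [hmono x hxs, le_of_position_le hx, hg s]
    rw [hps, hps'] at this
    exact lt_irrefl _ this
  · exact hne (injective_of_gap hΔ hgap h)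
  · have hgp := add_le_of_lt_of_gap hgap h
    -- If `s'` is better, all that is weakly ahead of `s'` under `g'` had `g`-index at least `μ s' -
    -- Δ / 2 ≥ μ s + Δ / 2`, so was ahead of `s`.
    have : position g' s' < position g s := by
      refine perm_apply_lt_of_forall_le fun x hx => position_lt_of_lt ?_
      have h1 := le_of_position_le hx
      by_cases hxs : x = s
      · rw [hxs] at h1; linarith [hg' s']
      · linarith [hslow x hxs, hg' s']
    rw [hps, hps'] at this
    exact lt_irrefl _ this

end Order

/-! ### Combinatorics of configurations: frozen ones are reachable -/

section Graph

variable {U C : ℕ}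

/-- User `j` shares its channel with another user. -/
def Shared (c : Fin U → Fin C) (j : Fin U) : Prop := ∃ j', j' ≠ j ∧ c j' = c j

/-- For some `E < U`, every user of estimate above `E` is alone on a channel that is not among
the `E` best ones. (`pos` is the position of a channel, `e` are the estimates.) -/
def Frozen (pos : Fin C → Fin C) (e : Fin U → ℕ) (c : Fin U → Fin C) : Prop :=
  ∃ E < U, ∀ j, E < e j → E ≤ (pos (c j)).val ∧ ¬ Shared c j

/-- A configuration: estimates, sensed channels, and which users redraw their rank. -/
abbrev Config (U C : ℕ) := (Fin U → ℕ) × (Fin U → Fin C) × (Fin U → Bool)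

/-- One slot in which all channels are free and the users that redraw move anywhere among the
best channels according to their estimates. -/
def Step (pos : Fin C → Fin C) (x y : Config U C) : Prop :=
  y.1 = x.1 ∧ (∀ j, (pos (y.2.1 j)).val < x.1 j) ∧ (∀ j, x.2.2 j = false → y.2.1 j = x.2.1 j) ∧
    ∀ j, y.2.2 j = true ↔ Shared y.2.1 j

/-- `Near pos k x`: a frozen configuration can be reached from `x` in at most `k` steps. -/
def Near (pos : Fin C → Fin C) : ℕ → Config U C → Prop
  | 0, x => Frozen pos x.1 x.2.1
  | k + 1, x => Near pos k x ∨ ∃ y, Step pos x y ∧ Near pos k y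

lemma Near.mono {pos : Fin C → Fin C} {k l : ℕ} (h : k ≤ l) {x : Config U C}
    (hx : Near pos k x) : Near pos l x := by
  induction h with
  | refl => exact hx
  | step _ ih => exact Or.inl ih

/-- Estimates are at most `U` and every user is on one of the best channels according to its
estimate. -/
def Config.Valid (pos : Fin C → Fin C) (x : Config U C) : Prop :=
  ∀ j, x.1 j ≤ U ∧ (pos (x.2.1 j)).val < x.1 j

open Classical in
/-- The largest estimate of a user that shares its channel. -/
noncomputable def sharedEstimate (e : Fin U → ℕ) (c : Fin U → Fin C) : ℕ :=
  (Finset.univ.filter (Shared c)).sup e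

lemma le_sharedEstimate {e : Fin U → ℕ} {c : Fin U → Fin C} {j : Fin U} (h : Shared c j) :
    e j ≤ sharedEstimate e c :=
  Finset.le_sup (f := e) (by simpa using h)

/-- The number of occupied channels. -/
def occupied (c : Fin U → Fin C) : ℕ := (Finset.univ.image c).card

lemma image_subset_image_update {c : Fin U → Fin C} {v : Fin U} (hv : Shared c v) (y : Fin C) :
    Finset.univ.image c ⊆ Finset.univ.image (Function.update c v y) := by
  intro x hx
  simp only [Finset.mem_image, Finset.mem_univ, true_and] at hx ⊢
  obtain ⟨j, rfl⟩ := hx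
  by_cases hj : j = v
  · obtain ⟨k, hk, hk'⟩ := hv
    exact ⟨k, by rw [Function.update_of_ne hk, hj, hk']⟩
  · exact ⟨j, by rw [Function.update_of_ne hj]⟩

lemma occupied_lt_of_shared {c : Fin U → Fin C} {v : Fin U} (hv : Shared c v) :
    occupied c < U := by
  refine lt_of_le_of_ne (Finset.card_image_le.trans_eq (by simp)) fun h => ?_
  have : Function.Injective c := by
    have := Finset.card_image_iff.1 (h.trans (by simp : U = (Finset.univ : Finset (Fin U)).card))
    simpa [Set.injOn_univ] using this
  obtain ⟨k, hk, hk'⟩ := hv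
  exact hk (this hk')

/-- The maximized quantity orders pairs (number of occupied channels, largest sharing estimate)
lexicographically, as estimates are at most `U`. At a maximum let the sharing user `v` have the
largest estimate `E`. The `E` best channels are all occupied, or `v` could move to a vacant one;
since some channel is shared, `E ≤ occupied c < U`. Users of estimate above `E` do not share; were
one of them among the `E` best, `v` could join it, vacating nothing and raising the second
component. -/
lemma frozen_of_maximal (pos : Equiv.Perm (Fin C)) (hUC : U ≤ C) (hU : 1 ≤ U) {e : Fin U → ℕ}
    {c : Fin U → Fin C} (he : ∀ j, e j ≤ U)
    (hmax : ∀ v y, Shared c v → (pos y).val < e v →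
      occupied (Function.update c v y) * (U + 1) + sharedEstimate e (Function.update c v y) ≤
        occupied c * (U + 1) + sharedEstimate e c) :
    Frozen pos e c := by
  classical
  by_cases hne : ∃ v, Shared c v
  · obtain ⟨v, hv, hvE⟩ : ∃ v, Shared c v ∧ e v = sharedEstimate e c := by
      obtain ⟨v, hv⟩ := hne
      obtain ⟨w, hw, hw'⟩ := Finset.exists_mem_eq_sup (Finset.univ.filter (Shared c))
        ⟨v, by simpa using hv⟩ e
      exact ⟨w, by simpa using hw, hw'.symm⟩
    have hsub := image_subset_image_update hv
    have hocc : ∀ y, (pos y).val < e v → y ∈ Finset.univ.image c := by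
      intro y hy
      by_contra hyc
      have hlt : occupied c < occupied (Function.update c v y) := by
        refine Finset.card_lt_card ⟨hsub y, fun h => hyc (h ?_)⟩
        exact Finset.mem_image.2 ⟨v, Finset.mem_univ _, by simp⟩
      have h1 := hmax v y hv hy
      have h2 : (occupied c + 1) * (U + 1) ≤ occupied (Function.update c v y) * (U + 1) :=
        Nat.mul_le_mul_right _ hlt
      have := he v
      rw [add_mul] at h2
      omega
    have hcard : e v ≤ occupied c := by
      have hle : e v ≤ C := (he v).trans hUC
      have h1 : (Finset.univ.image fun k : Fin (e v) => pos.symm ⟨k, k.isLt.trans_le hle⟩) ⊆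
          Finset.univ.image c := by
        intro x hx
        obtain ⟨k, -, rfl⟩ := Finset.mem_image.1 hx
        exact hocc _ (by simp)
      have h2 := Finset.card_le_card h1
      rw [Finset.card_image_of_injective _ (by
        intro a b hab
        have := pos.symm.injective hab
        simpa [Fin.ext_iff] using this)] at h2
      simpa [occupied] using h2
    refine ⟨e v, hcard.trans_lt (occupied_lt_of_shared hv), fun j hj => ⟨?_, fun hs => ?_⟩⟩
    · by_contra! hlt
      have hjv : j ≠ v := by rintro rfl; exact lt_irrefl _ hj
      have h1 := hmax v (c j) hv hlt
      have h2 : occupied c ≤ occupied (Function.update c v (c j)) :=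
        Finset.card_le_card (hsub _)
      have h3 : Shared (Function.update c v (c j)) j :=
        ⟨v, hjv.symm, by rw [Function.update_self, Function.update_of_ne hjv]⟩
      have h4 := le_sharedEstimate (e := e) h3
      have h5 := Nat.mul_le_mul_right (U + 1) h2
      omega
    · have := le_sharedEstimate (e := e) hs
      omega
  · push Not at hne
    exact ⟨0, hU, fun j _ => ⟨Nat.zero_le _, hne j⟩⟩

open Classical in
/-- The configuration with the given estimates and channels in which all sharing users redraw. -/
noncomputable def sharedConfig (e : Fin U → ℕ) (c : Fin U → Fin C) : Config U C :=
  (e, c, fun j => decide (Shared c j))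

/-- `c'` arises from `c` by moves of sharing users. -/
def Move (pos : Fin C → Fin C) (e : Fin U → ℕ) (c c' : Fin U → Fin C) : Prop :=
  Step pos (sharedConfig e c) (sharedConfig e c')

lemma exists_near_of_reflTransGen {pos : Fin C → Fin C} {e : Fin U → ℕ} {c c' : Fin U → Fin C}
    (h : Relation.ReflTransGen (Move pos e) c c') (hc' : Frozen pos e c') :
    ∃ k, Near pos k (sharedConfig e c) := by
  induction h using Relation.ReflTransGen.head_induction_on with
  | refl => exact ⟨0, hc'⟩
  | head h _ ih =>
    obtain ⟨k, hk⟩ := ih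
    exact ⟨k + 1, Or.inr ⟨_, h, hk⟩⟩

lemma valid_of_reflTransGen {pos : Fin C → Fin C} {e : Fin U → ℕ} {c c' : Fin U → Fin C}
    (hc : ∀ j, (pos (c j)).val < e j) (h : Relation.ReflTransGen (Move pos e) c c') :
    ∀ j, (pos (c' j)).val < e j := by
  induction h with
  | refl => exact hc
  | tail _ h _ => exact h.2.1

/-- Moving a single sharing user is a legitimate step, the other sharing users redrawing their
present channels. A maximizer over the finite set of reachable assignments therefore satisfies
`frozen_of_maximal`. -/
lemma exists_near (pos : Equiv.Perm (Fin C)) (hUC : U ≤ C) (hU : 1 ≤ U) {x : Config U C}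
    (hx : x.Valid pos) : ∃ k, Near pos k x := by
  classical
  obtain ⟨e, c, f⟩ := x
  have hc : ∀ j, (pos (c j)).val < e j := fun j => (hx j).2
  obtain ⟨c', hc', hmax⟩ := Set.exists_max_image
    {c' | Relation.ReflTransGen (Move pos e) c c'}
    (fun c' => occupied c' * (U + 1) + sharedEstimate e c') (Set.toFinite _)
    ⟨c, Relation.ReflTransGen.refl⟩
  have hfr : Frozen pos e c' := by
    refine frozen_of_maximal pos hUC hU (fun j => (hx j).1) fun v y hv hy => ?_
    refine hmax _ (Relation.ReflTransGen.tail hc' ⟨rfl, fun j => ?_, fun j hj => ?_, fun j => ?_⟩)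
    · by_cases hjv : j = v
      · subst hjv; simpa [sharedConfig] using hy
      · simpa [sharedConfig, hjv] using valid_of_reflTransGen hc hc' j
    · have hjv : j ≠ v := by rintro rfl; simp [sharedConfig, hv] at hj
      simp [sharedConfig, hjv]
    · simp [sharedConfig]
  obtain ⟨k, hk⟩ := exists_near_of_reflTransGen hc' hfr
  -- The redraw flags `f` are arbitrary; one step in place with all channels free makes them agree
  -- with sharing.
  refine ⟨k + 1, Or.inr ⟨sharedConfig e c, ⟨rfl, hc, fun _ _ => rfl, fun j => ?_⟩, hk⟩⟩
  simp [sharedConfig]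

lemma exists_forall_near (pos : Equiv.Perm (Fin C)) (hUC : U ≤ C) (hU : 1 ≤ U) :
    ∃ M, ∀ x : Config U C, x.Valid pos → Near pos M x := by
  have hfin : {x : Config U C | x.Valid pos}.Finite := by
    refine Set.Finite.subset (Set.Finite.prod (Set.Finite.pi' fun _ => Set.finite_Iic U)
      Set.finite_univ) fun x hx => ⟨fun j => (hx j).1, Set.mem_univ _⟩
  have hbdd : ∀ s : Set (Config U C), s.Finite → (∀ x ∈ s, ∃ k, Near pos k x) →
      ∃ M, ∀ x ∈ s, Near pos M x := by
    intro s hs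
    induction s, hs using Set.Finite.induction_on with
    | empty => exact fun _ => ⟨0, by simp⟩
    | insert _ _ ih =>
      intro h
      obtain ⟨k, hk⟩ := h _ (Set.mem_insert _ _)
      obtain ⟨M, hM⟩ := ih fun x hx => h x (Set.mem_insert_of_mem _ hx)
      refine ⟨max k M, ?_⟩
      rintro x (rfl | hx)
      · exact hk.mono (le_max_left _ _)
      · exact (hM x hx).mono (le_max_right _ _)
  exact hbdd _ hfin fun x hx => exists_near pos hUC hU hx

end Graph

variable {U C : ℕ}

/-! ### Effect of a single slot on the memories -/

section Slot

lemma collisionCount_le (s : UserState C) (t k : ℕ) :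
    s.collisionCount t k ≤ ∑ i, s.collisions i := by
  refine (Finset.sum_le_sum_of_subset (Finset.filter_subset _ _)).trans_eq ?_
  exact Equiv.sum_comp (sigmaPerm (s.gMean t)) s.collisions

lemma sum_update_add {ι : Type*} [Fintype ι] [DecidableEq ι] (f : ι → ℕ) (i : ι) (k : ℕ) :
    ∑ x, Function.update f i (f i + k) x = ∑ x, f x + k := by
  rw [Finset.sum_update_of_mem (Finset.mem_univ i),
    ← Finset.add_sum_erase _ f (Finset.mem_univ i), Finset.sdiff_singleton_eq_erase]
  ring

lemma testEstimate_sensed (ξ : ℕ → ℝ) (t : ℕ) (s : UserState C) : (s.testEstimate ξ t).sensed = s.sensed := by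
  unfold UserState.testEstimate; split <;> rfl

lemma testEstimate_free (ξ : ℕ → ℝ) (t : ℕ) (s : UserState C) : (s.testEstimate ξ t).free = s.free := by
  unfold UserState.testEstimate; split <;> rfl

variable [NeZero C]

/-- The channels sensed in slot `t + 1` from the memories `S`. -/
noncomputable def sensedChannel (ord : Fin U → Equiv.Perm (Fin C)) (t : ℕ)
    (S : Fin U → UserState C) (d : Fin U → ℕ → ℕ) (j : Fin U) : Fin C :=
  if h : t < C then ord j ⟨t, h⟩ else ((S j).redraw (d j)).channel t

/-- Slot `t + 1` of the policy. -/
noncomputable def slot (ξ : ℕ → ℝ) (ord : Fin U → Equiv.Perm (Fin C)) (t : ℕ)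
    (S : Fin U → UserState C) (w : Fin C → ℕ) (d : Fin U → ℕ → ℕ) : Fin U → UserState C :=
  if h : t < C then initSlot S (fun j => ord j ⟨t, h⟩) w else loopSlot ξ t S w d

lemma run_succ (ξ : ℕ → ℝ) (ord : Fin U → Equiv.Perm (Fin C)) (w : Fin C → ℕ → ℕ)
    (d : Fin U → ℕ → ℕ → ℕ) (t : ℕ) :
    run ξ ord w d (t + 1) =
      slot ξ ord t (run ξ ord w d t) (fun i => w i (t + 1)) (fun j => d j (t + 1)) := rfl

variable (ξ : ℕ → ℝ) (ord : Fin U → Equiv.Perm (Fin C)) (t : ℕ)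
    (S : Fin U → UserState C) (w : Fin C → ℕ) (d : Fin U → ℕ → ℕ) (j : Fin U)

/-- The memory of a user after slot `t + 1` of the main loop, before the test. -/
noncomputable def untested : UserState C :=
  (((S j).redraw (d j)).recordSense (sensedChannel ord t S d j)
    (w (sensedChannel ord t S d j))).recordCollision (sensedChannel ord t S d j)
      (decide (w (sensedChannel ord t S d j) = 1 ∧
        ∃ j' : Fin U, j' ≠ j ∧ sensedChannel ord t S d j' = sensedChannel ord t S d j))

variable {t} in
lemma slot_of_le (ht : C ≤ t) :
    slot ξ ord t S w d j = (untested ord t S w d j).testEstimate ξ (t + 1) := by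
  simp only [slot, untested, loopSlot, sensedChannel, not_lt.2 ht, dite_false]

lemma slot_sensed : (slot ξ ord t S w d j).sensed =
    Function.update (S j).sensed (sensedChannel ord t S d j)
      ((S j).sensed (sensedChannel ord t S d j) + 1) := by
  by_cases ht : t < C
  · simp [slot, sensedChannel, ht, initSlot, UserState.recordSense]
  · rw [slot_of_le ξ ord S w d j (not_lt.1 ht), testEstimate_sensed]
    rfl

lemma slot_free : (slot ξ ord t S w d j).free =
    Function.update (S j).free (sensedChannel ord t S d j)
      ((S j).free (sensedChannel ord t S d j) + w (sensedChannel ord t S d j)) := by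
  by_cases ht : t < C
  · simp [slot, sensedChannel, ht, initSlot, UserState.recordSense]
  · rw [slot_of_le ξ ord S w d j (not_lt.1 ht), testEstimate_free]
    rfl

lemma slot_estimate : (slot ξ ord t S w d j).estimate = (S j).estimate ∨
    (slot ξ ord t S w d j).estimate = (S j).estimate + 1 := by
  by_cases ht : t < C
  · simp [slot, ht, initSlot, UserState.recordSense]
  · rw [slot_of_le ξ ord S w d j (not_lt.1 ht), UserState.testEstimate]
    split
    · exact Or.inr rfl
    · exact Or.inl rfl

lemma le_slot_estimate : (S j).estimate ≤ (slot ξ ord t S w d j).estimate := by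
  rcases slot_estimate ξ ord t S w d j with h | h <;> omega

variable {ξ ord t S w d j}

lemma slot_eq_untested (ht : C ≤ t)
    (h : (slot ξ ord t S w d j).estimate = (S j).estimate) :
    slot ξ ord t S w d j = untested ord t S w d j := by
  rw [slot_of_le ξ ord S w d j ht, UserState.testEstimate] at h ⊢
  split at h
  · have : (untested ord t S w d j).estimate = (S j).estimate := rfl
    simp only [this] at h
    omega
  · rename_i hlt
    rw [if_neg hlt]

lemma slot_of_estimate_ne (ht : C ≤ t)
    (h : (slot ξ ord t S w d j).estimate ≠ (S j).estimate) :
    ξ (S j).estimate <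
        ((untested ord t S w d j).collisionCount (t + 1) (S j).estimate : ℝ) ∧
      (slot ξ ord t S w d j).collisions = fun _ => 0 := by
  rw [slot_of_le ξ ord S w d j ht, UserState.testEstimate] at h ⊢
  split at h
  · rename_i hlt
    rw [if_pos hlt]
    exact ⟨hlt, rfl⟩
  · exact absurd rfl h

lemma slot_rank (ht : C ≤ t) :
    (slot ξ ord t S w d j).rank = ((S j).redraw (d j)).rank := by
  rw [slot_of_le ξ ord S w d j ht, UserState.testEstimate]
  split <;> rfl

lemma shared_of_slot_collided (ht : C ≤ t) (h : (slot ξ ord t S w d j).collided = true) :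
    Shared (sensedChannel ord t S d) j := by
  rw [slot_of_le ξ ord S w d j ht, UserState.testEstimate] at h
  split at h
  · simp at h
  · exact (of_decide_eq_true h).2

lemma slot_collided_iff (ht : C ≤ t) (hw : ∀ i, w i = 1)
    (h : (slot ξ ord t S w d j).estimate = (S j).estimate) :
    (slot ξ ord t S w d j).collided = true ↔ Shared (sensedChannel ord t S d) j := by
  rw [slot_eq_untested ht h]
  simp [untested, UserState.recordCollision, hw, Shared]

open Classical in
lemma sum_untested_collisions_le : ∑ i, (untested ord t S w d j).collisions i ≤
    ∑ i, (S j).collisions i + if Shared (sensedChannel ord t S d) j then 1 else 0 := by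
  change ∑ i, Function.update (S j).collisions _ ((S j).collisions _ + _) i ≤ _
  rw [sum_update_add]
  gcongr
  split_ifs with h1 h2 h2
  · exact le_rfl
  · exact absurd (of_decide_eq_true h1).2 h2
  all_goals simp

end Slot

/-! ### Accuracy and slow growth of the channel statistics -/

section Index

/-- The sample means are within the confidence radius of the means. -/
def Concentrated (μ : Fin C → ℝ) (t : ℕ) (S : Fin U → UserState C) : Prop :=
  ∀ j i, |((S j).free i : ℝ) / ((S j).sensed i : ℝ) - μ i| ≤
    Real.sqrt (2 * Real.log t / ((S j).sensed i : ℝ))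

/-- Channel `i` has been sensed often enough, for horizon `n`, to be distinguished from
others at distance `Δ`. -/
def UserState.Saturated (Δ : ℝ) (n : ℕ) (s : UserState C) (i : Fin C) : Prop :=
  32 * Real.log n < Δ ^ 2 * (s.sensed i : ℝ)

variable {μ : Fin C → ℝ} {Δ : ℝ} {n t : ℕ} {S : Fin U → UserState C}

lemma Concentrated.le_gMean (h : Concentrated μ t S) (j : Fin U) (i : Fin C) :
    μ i ≤ (S j).gMean t i := by
  have := (abs_le.1 (h j i)).1
  unfold UserState.gMean
  linarith

lemma Concentrated.gMean_lt (h : Concentrated μ t S) (hΔ : 0 < Δ) (ht : 1 ≤ t) (htn : t ≤ n)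
    {j : Fin U} {i : Fin C} (hi : (S j).Saturated Δ n i) :
    (S j).gMean t i < μ i + Δ / 2 := by
  have h1 := (abs_le.1 (h j i)).2
  have hlog : Real.log t ≤ Real.log n :=
    Real.log_le_log (by exact_mod_cast ht) (by exact_mod_cast htn)
  have hlog0 : 0 ≤ Real.log t := Real.log_natCast_nonneg t
  unfold UserState.Saturated at hi
  have hT : (0 : ℝ) < (S j).sensed i := by
    by_contra! hle
    nlinarith [sq_nonneg Δ]
  -- Saturation means `2 * log n / T < Δ ^ 2 / 16`; sampling error and confidence term are then each
  -- below `Δ / 4`.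
  have h2 : Real.sqrt (2 * Real.log t / ((S j).sensed i : ℝ)) < Δ / 4 := by
    rw [Real.sqrt_lt' (by positivity), div_lt_iff₀ hT]
    nlinarith
  unfold UserState.gMean
  linarith

lemma gMean_mono_time {s s' : UserState C} {i : Fin C} (ht : 1 ≤ t)
    (hs : s'.sensed i = s.sensed i) (hf : s'.free i = s.free i) :
    s.gMean t i ≤ s'.gMean (t + 1) i := by
  unfold UserState.gMean
  rw [hs, hf]
  have : Real.log t ≤ Real.log (t + 1 : ℕ) :=
    Real.log_le_log (by exact_mod_cast ht) (by push_cast; linarith)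
  gcongr

/-- Uses `log (t + 1) ≤ log t + 1 / t` and `√(a + Δ ^ 2 / 4) ≤ √a + Δ / 2`. The bound `8 < Δ ^ 2 *
t` gives `2 / t ≤ Δ ^ 2 / 4`; it is why early slots count as disrupted. -/
lemma gMean_slow {s s' : UserState C} {i : Fin C} (ht : 1 ≤ t) (hΔ : 0 < Δ)
    (htΔ : 8 < Δ ^ 2 * t) (hT : 1 ≤ s.sensed i)
    (hs : s'.sensed i = s.sensed i) (hf : s'.free i = s.free i) :
    s'.gMean (t + 1) i ≤ s.gMean t i + Δ / 2 := by
  unfold UserState.gMean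
  rw [hs, hf]
  have ht' : (0 : ℝ) < t := by exact_mod_cast ht
  have hT' : (1 : ℝ) ≤ s.sensed i := by exact_mod_cast hT
  have hlog : Real.log (t + 1 : ℕ) ≤ Real.log t + 1 / t := by
    have h1 : Real.log ((t + 1 : ℕ) / t) ≤ (t + 1 : ℕ) / t - 1 :=
      Real.log_le_sub_one_of_pos (by positivity)
    rw [Real.log_div (by positivity) ht'.ne'] at h1
    have h2 : ((t + 1 : ℕ) : ℝ) / t - 1 = 1 / t := by push_cast; field_simp; ring
    linarith
  have h3 : Real.sqrt (2 * Real.log (t + 1 : ℕ) / (s.sensed i : ℝ)) ≤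
      Real.sqrt (2 * Real.log t / (s.sensed i : ℝ)) + Δ / 2 := by
    refine Real.sqrt_le_iff.2 ⟨by positivity, ?_⟩
    have h4 : 2 * Real.log (t + 1 : ℕ) / (s.sensed i : ℝ) ≤
        2 * Real.log t / (s.sensed i : ℝ) + Δ ^ 2 / 4 := by
      have h5 : 2 / (t : ℝ) ≤ Δ ^ 2 / 4 := by
        rw [div_le_iff₀ ht']; nlinarith
      have h6 : 2 * (1 / (t : ℝ)) / (s.sensed i : ℝ) ≤ 2 / t := by
        rw [mul_one_div]
        exact div_le_self (by positivity) hT'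
      calc 2 * Real.log (t + 1 : ℕ) / (s.sensed i : ℝ)
          ≤ 2 * (Real.log t + 1 / t) / (s.sensed i : ℝ) := by gcongr
        _ = 2 * Real.log t / (s.sensed i : ℝ) + 2 * (1 / (t : ℝ)) / (s.sensed i : ℝ) := by ring
        _ ≤ _ := by linarith
    have h7 : 0 ≤ 2 * Real.log t / (s.sensed i : ℝ) :=
      div_nonneg (mul_nonneg zero_le_two (Real.log_natCast_nonneg t)) (by linarith)
    have h8 := Real.sq_sqrt h7
    have h9 := Real.sqrt_nonneg (2 * Real.log t / (s.sensed i : ℝ))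
    nlinarith
  linarith

end Index

/-! ### Undisrupted slots of a run, and what over-estimation costs -/

section Trajectory

variable [NeZero C] (ξ : ℕ → ℝ) (ord : Fin U → Equiv.Perm (Fin C)) (w : Fin C → ℕ → ℕ)
  (d : Fin U → ℕ → ℕ → ℕ)

/-- The channels sensed in slot `t + 1`. -/
noncomputable def channels (t : ℕ) : Fin U → Fin C :=
  sensedChannel ord t (run ξ ord w d t) (fun j => d j (t + 1))

lemma run_estimate_mono (t : ℕ) (j : Fin U) :
    (run ξ ord w d t j).estimate ≤ (run ξ ord w d (t + 1) j).estimate := by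
  rw [run_succ]
  exact le_slot_estimate ..

lemma one_le_run_estimate (t : ℕ) (j : Fin U) : 1 ≤ (run ξ ord w d t j).estimate := by
  induction t with
  | zero => exact le_rfl
  | succ t ih => exact ih.trans (run_estimate_mono ..)

lemma run_of_le {t : ℕ} (ht : t ≤ C) (j : Fin U) :
    (run ξ ord w d t j).estimate = 1 ∧ (run ξ ord w d t j).rank = 1 ∧
      (run ξ ord w d t j).collisions = (fun _ => 0) ∧ (run ξ ord w d t j).collided = false ∧
      ∀ i, (run ξ ord w d t j).sensed i = if ((ord j).symm i).val < t then 1 else 0 := by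
  induction t with
  | zero => exact ⟨rfl, rfl, rfl, rfl, fun i => by simp [run, UserState.start]⟩
  | succ t ih =>
    obtain ⟨h1, h2, h3, h4, h5⟩ := ih (by omega)
    have ht' : t < C := ht
    rw [run_succ]
    refine ⟨by simpa [slot, ht', initSlot, UserState.recordSense],
      by simpa [slot, ht', initSlot, UserState.recordSense],
      by simpa [slot, ht', initSlot, UserState.recordSense],
      by simpa [slot, ht', initSlot, UserState.recordSense], fun i => ?_⟩
    rw [slot_sensed]
    simp only [sensedChannel, ht', dite_true]
    by_cases hi : i = ord j ⟨t, ht'⟩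
    · subst hi
      simp [h5]
    · rw [Function.update_of_ne hi, h5]
      have : ((ord j).symm i).val ≠ t := fun h =>
        hi ((Equiv.symm_apply_eq (ord j)).1 (Fin.ext h))
      have h6 : ((ord j).symm i).val < t ↔ ((ord j).symm i).val < t + 1 := by omega
      simp [h6]

lemma run_sensed_mono (t : ℕ) (j : Fin U) (i : Fin C) :
    (run ξ ord w d t j).sensed i ≤ (run ξ ord w d (t + 1) j).sensed i := by
  rw [run_succ, slot_sensed]
  by_cases hi : i = sensedChannel ord t (run ξ ord w d t) (fun j => d j (t + 1)) j
  · rw [← hi]; simp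
  · rw [Function.update_of_ne hi]

lemma one_le_run_sensed {t : ℕ} (ht : C ≤ t) (j : Fin U) (i : Fin C) :
    1 ≤ (run ξ ord w d t j).sensed i := by
  induction t, ht using Nat.le_induction with
  | base => simp [(run_of_le ξ ord w d le_rfl j).2.2.2.2 i]
  | succ t _ ih => exact ih.trans (run_sensed_mono ..)

lemma run_sensed_le (t : ℕ) (j : Fin U) (i : Fin C) : (run ξ ord w d t j).sensed i ≤ t := by
  induction t with
  | zero => simp [run, UserState.start]
  | succ t ih =>
    rw [run_succ, slot_sensed, Function.update_apply]
    split_ifs with h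
    · rw [← h]; omega
    · omega

lemma run_rank_mem (hd : ∀ j k u, 1 ≤ u → d j k u ∈ Finset.Icc 1 u) (t : ℕ) (j : Fin U) :
    (run ξ ord w d t j).rank ∈ Finset.Icc 1 (run ξ ord w d t j).estimate := by
  induction t with
  | zero => simp [run, UserState.start]
  | succ t ih =>
    by_cases ht : t < C
    · obtain ⟨h1, h2, -⟩ := run_of_le ξ ord w d (t := t + 1) ht j
      simp [h1, h2]
    · have := run_estimate_mono ξ ord w d t j
      have h1 := one_le_run_estimate ξ ord w d t j
      rw [run_succ] at this ⊢
      rw [slot_rank (not_lt.1 ht), UserState.redraw]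
      refine Finset.Icc_subset_Icc_right this ?_
      dsimp only
      split_ifs
      · exact hd _ _ _ h1
      · exact ih

lemma redraw_rank_mem (hd : ∀ j k u, 1 ≤ u → d j k u ∈ Finset.Icc 1 u) (t : ℕ) (j : Fin U) :
    ((run ξ ord w d t j).redraw (d j (t + 1))).rank ∈
      Finset.Icc 1 (run ξ ord w d t j).estimate := by
  have := run_rank_mem ξ ord w d hd t j
  have h1 := one_le_run_estimate ξ ord w d t j
  unfold UserState.redraw
  dsimp only
  split_ifs
  · exact hd _ _ _ h1
  · exact this

/-- Some user has over-estimated the number of users. -/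
def Over (S : Fin U → UserState C) : Prop := ∃ j, U < (S j).estimate

/-- Slot `t + 1`, from memories `S` to memories `S'` with channels `c` sensed, is early, or starts
from inaccurate statistics, or has an insufficiently explored channel sensed, or changes an
estimate. -/
def Disrupted (μ : Fin C → ℝ) (Δ : ℝ) (n t : ℕ) (S : Fin U → UserState C) (c : Fin U → Fin C)
    (S' : Fin U → UserState C) : Prop :=
  Δ ^ 2 * t ≤ 8 ∨ ¬ Concentrated μ t S ∨ (∃ j, ¬ (S j).Saturated Δ n (c j)) ∨
    ∃ j, (S' j).estimate ≠ (S j).estimate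

/-- Slot `t + 1` of the run is disrupted. -/
def RunDisrupted (μ : Fin C → ℝ) (Δ : ℝ) (n t : ℕ) : Prop :=
  Disrupted μ Δ n t (run ξ ord w d t) (channels ξ ord w d t) (run ξ ord w d (t + 1))

variable {ξ ord w d}

lemma over_succ {t : ℕ} (h : Over (run ξ ord w d t)) : Over (run ξ ord w d (t + 1)) := by
  obtain ⟨j, hj⟩ := h
  exact ⟨j, hj.trans_le (run_estimate_mono ..)⟩

lemma channels_of_le {t : ℕ} (ht : C ≤ t) (j : Fin U) :
    channels ξ ord w d t j = sigma ((run ξ ord w d t j).gMean t)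
      (Fin.ofNat C (((run ξ ord w d t j).redraw (d j (t + 1))).rank - 1)) := by
  unfold channels sensedChannel
  rw [dif_neg (not_lt.2 ht)]
  rfl

variable {μ : Fin C → ℝ} {Δ : ℝ} {n t : ℕ}

/-- By `position_le_position`, the true position of a saturated channel is no later than its place
in the user's own ranking, which lies within the estimate. -/
lemma position_channels_lt (hΔ : 0 < Δ) (hgap : ∀ x y, x ≠ y → Δ ≤ |μ x - μ y|)
    (hUC : U ≤ C) (hd : ∀ j k u, 1 ≤ u → d j k u ∈ Finset.Icc 1 u) (ht : C ≤ t) (htn : t ≤ n)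
    (hover : ¬ Over (run ξ ord w d t)) (hdis : ¬ RunDisrupted ξ ord w d μ Δ n t) (j : Fin U) :
    (position μ (channels ξ ord w d t j)).val < (run ξ ord w d t j).estimate := by
  simp only [RunDisrupted, Disrupted, not_or, not_not, not_exists, not_le] at hdis
  obtain ⟨-, hconc, hsat, -⟩ := hdis
  have ht1 : 1 ≤ t := (NeZero.one_le (n := C)).trans ht
  have h1 := position_le_position hΔ hgap (hconc.le_gMean j) (hconc.gMean_lt hΔ ht1 htn (hsat j))
  have h2 := Finset.mem_Icc.1 (redraw_rank_mem ξ ord w d hd t j)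
  have h3 : (run ξ ord w d t j).estimate ≤ U := by
    by_contra! h; exact hover ⟨j, h⟩
  rw [Fin.le_def] at h1
  refine h1.trans_lt ?_
  -- The rank is at most `U ≤ C`, so reading it modulo `C` changes nothing.
  rw [channels_of_le ht, position_sigma, Fin.val_ofNat, Nat.mod_eq_of_lt (by omega)]
  omega

/-- Without a recorded collision the rank is kept, and in between only the sensed channel gains an
observation and stays saturated, so `sigma_eq_sigma` applies. -/
lemma channels_succ (hΔ : 0 < Δ) (hgap : ∀ x y, x ≠ y → Δ ≤ |μ x - μ y|)
    (ht : C ≤ t) (htn : t < n)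
    (hdis : ¬ RunDisrupted ξ ord w d μ Δ n t) (hdis' : ¬ RunDisrupted ξ ord w d μ Δ n (t + 1))
    {j : Fin U} (hj : (run ξ ord w d (t + 1) j).collided = false) :
    channels ξ ord w d (t + 1) j = channels ξ ord w d t j := by
  simp only [RunDisrupted, Disrupted, not_or, not_not, not_exists, not_le] at hdis hdis'
  obtain ⟨hlate, hconc, hsat, -⟩ := hdis
  obtain ⟨-, hconc', hsat', -⟩ := hdis'
  have ht1 : 1 ≤ t := (NeZero.one_le (n := C)).trans ht
  have hrank : ((run ξ ord w d (t + 1) j).redraw (d j (t + 1 + 1))).rank =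
      ((run ξ ord w d t j).redraw (d j (t + 1))).rank := by
    rw [UserState.redraw, hj, run_succ]
    exact slot_rank ht
  have hS : ∀ x, x ≠ channels ξ ord w d t j →
      (run ξ ord w d (t + 1) j).sensed x = (run ξ ord w d t j).sensed x ∧
      (run ξ ord w d (t + 1) j).free x = (run ξ ord w d t j).free x := by
    intro x hx
    rw [run_succ, slot_sensed, slot_free]
    exact ⟨Function.update_of_ne hx _ _, Function.update_of_ne hx _ _⟩
  have hs := hsat j
  have hs' := hsat' j
  have hs2 : (run ξ ord w d (t + 1) j).Saturated Δ n (channels ξ ord w d t j) := by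
    refine lt_of_lt_of_le hs ?_
    have := run_sensed_mono ξ ord w d t j (channels ξ ord w d t j)
    gcongr
  rw [channels_of_le ht] at hs hs2 hS ⊢
  rw [channels_of_le (ht.trans t.le_succ), hrank] at hs' ⊢
  exact sigma_eq_sigma hΔ hgap (hconc.le_gMean j) (hconc'.le_gMean j)
    (hconc.gMean_lt hΔ ht1 htn.le hs) (hconc'.gMean_lt hΔ (by omega) htn hs2)
    (hconc'.gMean_lt hΔ (by omega) htn hs')
    (fun x hx => gMean_mono_time ht1 (hS x hx).1 (hS x hx).2)
    (fun x hx => gMean_slow ht1 hΔ hlate (one_le_run_sensed ξ ord w d ht j x)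
      (hS x hx).1 (hS x hx).2)

/-- The configuration of a slot with memories `S` before and `S'` after it and channels `c`. -/
noncomputable def config (S : Fin U → UserState C) (c : Fin U → Fin C)
    (S' : Fin U → UserState C) : Config U C :=
  (fun j => (S j).estimate, c, fun j => (S' j).collided)

variable (ξ ord w d t) in
/-- The configuration in slot `t + 1` of the run. -/
noncomputable def runConfig : Config U C :=
  config (run ξ ord w d t) (channels ξ ord w d t) (run ξ ord w d (t + 1))

lemma runConfig_valid (hΔ : 0 < Δ) (hgap : ∀ x y, x ≠ y → Δ ≤ |μ x - μ y|)
    (hUC : U ≤ C) (hd : ∀ j k u, 1 ≤ u → d j k u ∈ Finset.Icc 1 u) (ht : C ≤ t) (htn : t ≤ n)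
    (hover : ¬ Over (run ξ ord w d t)) (hdis : ¬ RunDisrupted ξ ord w d μ Δ n t) :
    (runConfig ξ ord w d t).Valid (position μ) := by
  refine fun j => ⟨?_, position_channels_lt hΔ hgap hUC hd ht htn hover hdis j⟩
  by_contra! h
  exact hover ⟨j, h⟩

lemma estimate_eq_of_not_disrupted (hdis : ¬ RunDisrupted ξ ord w d μ Δ n t) (j : Fin U) :
    (run ξ ord w d (t + 1) j).estimate = (run ξ ord w d t j).estimate := by
  simp only [RunDisrupted, Disrupted, not_or, not_not, not_exists, not_le] at hdis
  exact hdis.2.2.2 j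

/-- Users of estimate above `E` are alone, have no collision and stay put. The others remain among
the `E` best channels, where none of the former sit, so no sharing with them can arise. -/
lemma frozen_succ (hΔ : 0 < Δ) (hgap : ∀ x y, x ≠ y → Δ ≤ |μ x - μ y|)
    (hUC : U ≤ C) (hd : ∀ j k u, 1 ≤ u → d j k u ∈ Finset.Icc 1 u) (ht : C ≤ t) (htn : t < n)
    (hover : ¬ Over (run ξ ord w d (t + 1)))
    (hdis : ¬ RunDisrupted ξ ord w d μ Δ n t) (hdis' : ¬ RunDisrupted ξ ord w d μ Δ n (t + 1))
    (hfr : Near (position μ) 0 (runConfig ξ ord w d t)) :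
    Near (position μ) 0 (runConfig ξ ord w d (t + 1)) := by
  obtain ⟨E, hE, hfr⟩ := hfr
  have hest := estimate_eq_of_not_disrupted hdis
  have hkeep : ∀ j, E < (run ξ ord w d t j).estimate →
      channels ξ ord w d (t + 1) j = channels ξ ord w d t j := by
    intro j hj
    refine channels_succ hΔ hgap ht htn hdis hdis' ?_
    by_contra hcol
    rw [Bool.not_eq_false, run_succ] at hcol
    exact (hfr j hj).2 (shared_of_slot_collided ht hcol)
  refine ⟨E, hE, fun j hj => ?_⟩
  change E < (run ξ ord w d (t + 1) j).estimate at hj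
  rw [hest] at hj
  have hfrj := hfr j hj
  change E ≤ (position μ (channels ξ ord w d (t + 1) j)).val ∧
    ¬ Shared (channels ξ ord w d (t + 1)) j
  change E ≤ (position μ (channels ξ ord w d t j)).val ∧
    ¬ Shared (channels ξ ord w d t) j at hfrj
  rw [hkeep j hj]
  refine ⟨hfrj.1, ?_⟩
  rintro ⟨k, hkj, hk⟩
  rw [hkeep j hj] at hk
  by_cases hEk : E < (run ξ ord w d t k).estimate
  · rw [hkeep k hEk] at hk
    exact hfrj.2 ⟨k, hkj, hk⟩
  · have := position_channels_lt hΔ hgap hUC hd (ht.trans t.le_succ) htn hover hdis' k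
    rw [hk, hest] at this
    omega

/-- `r` is a rank, within the estimate, of channel `x` or of an insufficiently explored one. -/
def IsTargetRank (Δ : ℝ) (n t : ℕ) (s : UserState C) (x : Fin C) (r : ℕ) : Prop :=
  r ∈ Finset.Icc 1 s.estimate ∧ (sigma (s.gMean t) (Fin.ofNat C (r - 1)) = x ∨
    ¬ s.Saturated Δ n (sigma (s.gMean t) (Fin.ofNat C (r - 1))))

/-- If all channels within the estimate in the user's ranking are saturated, they comprise the truly
best ones, including `x`. Otherwise some rank leads to an unsaturated channel; sensing it makes the
slot disrupted, which is accounted for separately. -/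
lemma exists_isTargetRank (hΔ : 0 < Δ) (hgap : ∀ x y, x ≠ y → Δ ≤ |μ x - μ y|)
    {S : Fin U → UserState C} (ht : 1 ≤ t) (htn : t ≤ n) (hconc : Concentrated μ t S)
    (j : Fin U) {x : Fin C}
    (hx : (position μ x).val < (S j).estimate) : ∃ r, IsTargetRank Δ n t (S j) x r := by
  by_cases h : ∃ y, (position ((S j).gMean t) y).val < (S j).estimate ∧ ¬ (S j).Saturated Δ n y
  · obtain ⟨y, hy, hy'⟩ := h
    refine ⟨(position ((S j).gMean t) y).val + 1, by simp; omega, Or.inr ?_⟩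
    simpa using hy'
  · push Not at h
    have := position_lt_of_top hΔ hgap (hconc.le_gMean j)
      (fun y hy => hconc.gMean_lt hΔ ht htn (h y hy)) hx
    exact ⟨(position ((S j).gMean t) x).val + 1, by simp; omega, Or.inl (by simp)⟩

open Classical in
/-- A rank of channel `x` or of an insufficiently explored one, if there is one. -/
noncomputable def targetRank (Δ : ℝ) (n t : ℕ) (s : UserState C) (x : Fin C) : ℕ :=
  if h : ∃ r, IsTargetRank Δ n t s x r then h.choose else 1

/-- The default value `1` is also a possible outcome of the draw, so aims have positive probability
in every case. -/
lemma targetRank_mem (s : UserState C) (hs : 1 ≤ s.estimate) (x : Fin C) :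
    targetRank Δ n t s x ∈ Finset.Icc 1 s.estimate := by
  unfold targetRank
  split_ifs with h
  · exact h.choose_spec.1
  · simpa using hs

/-- A redrawing user with its target rank is on the desired channel or on an unsaturated one, and
the latter would disrupt the slot. With all channels free, collision flags coincide with sharing. -/
lemma runConfig_succ_of_step (hΔ : 0 < Δ) (hgap : ∀ x y, x ≠ y → Δ ≤ |μ x - μ y|)
    (ht : C ≤ t) (htn : t < n)
    (hdis : ¬ RunDisrupted ξ ord w d μ Δ n t) (hdis' : ¬ RunDisrupted ξ ord w d μ Δ n (t + 1))
    {y : Config U C} (hy : Step (position μ) (runConfig ξ ord w d t) y)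
    (hw : ∀ i, w i (t + 1 + 1) = 1)
    (hr : ∀ j, d j (t + 1 + 1) (run ξ ord w d (t + 1) j).estimate =
      targetRank Δ n (t + 1) (run ξ ord w d (t + 1) j) (y.2.1 j)) :
    runConfig ξ ord w d (t + 1) = y := by
  obtain ⟨hye, hyt, hyk, hys⟩ := hy
  have hest := estimate_eq_of_not_disrupted hdis
  have hest' := estimate_eq_of_not_disrupted hdis'
  have hch : channels ξ ord w d (t + 1) = y.2.1 := by
    funext j
    cases hcol : (run ξ ord w d (t + 1) j).collided with
    | false => rw [hyk j hcol]; exact channels_succ hΔ hgap ht htn hdis hdis' hcol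
    | true =>
      have hdis2 := hdis'
      simp only [RunDisrupted, Disrupted, not_or, not_not, not_exists, not_le] at hdis2
      obtain ⟨-, hconc', hsat', -⟩ := hdis2
      have hex : ∃ r, IsTargetRank Δ n (t + 1) (run ξ ord w d (t + 1) j) (y.2.1 j) r := by
        refine exists_isTargetRank hΔ hgap (by omega) htn hconc' j ?_
        rw [hest]; exact hyt j
      have hspec := hex.choose_spec.2
      have hrank : ((run ξ ord w d (t + 1) j).redraw (d j (t + 1 + 1))).rank = hex.choose := by
        simp only [UserState.redraw, hcol, if_true, hr]
        rw [targetRank, dif_pos hex]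
      have hsatj := hsat' j
      rw [channels_of_le (ht.trans t.le_succ), hrank] at hsatj ⊢
      exact hspec.resolve_right (not_not.2 hsatj)
  refine Prod.ext ?_ (Prod.ext hch ?_)
  · rw [hye]
    exact funext hest
  · funext j
    have h1 : (run ξ ord w d (t + 1 + 1) j).collided = true ↔
        Shared (channels ξ ord w d (t + 1)) j := by
      have h2 := hest' j
      rw [run_succ] at h2 ⊢
      exact slot_collided_iff (ht.trans t.le_succ) hw h2
    rw [hch, ← hys] at h1
    exact Bool.eq_iff_iff.2 h1

variable (ξ ord w d μ Δ n) in
/-- Before over-estimation, slot `t + 1` of the run is disrupted or its configuration is not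
frozen. -/
def Unsettled (t : ℕ) : Prop :=
  ¬ Over (run ξ ord w d t) ∧
    (RunDisrupted ξ ord w d μ Δ n t ∨ ¬ Near (position μ) 0 (runConfig ξ ord w d t))

/-- This is the purpose of `E < U` in `Frozen`: an estimate equal to `U` exceeds every admissible
`E`. -/
lemma not_shared_of_not_unsettled {j : Fin U} (hover : ¬ Over (run ξ ord w d t))
    (h : ¬ Unsettled ξ ord w d μ Δ n t) (hj : (run ξ ord w d t j).estimate = U) :
    ¬ Shared (channels ξ ord w d t) j := by
  simp only [Unsettled, not_and, not_or, not_not] at h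
  obtain ⟨E, hE, hfr⟩ := (h hover).2
  refine (hfr j ?_).2
  change E < (run ξ ord w d t j).estimate
  omega

open Classical in
-- Reaching estimate `U` discards all records, and each later collision of the user falls in an
-- unsettled slot.
lemma sum_collisions_le {j : Fin U} (hU : 2 ≤ U) (hj : (run ξ ord w d t j).estimate = U)
    (hover : ¬ Over (run ξ ord w d t)) :
    ∑ i, (run ξ ord w d t j).collisions i ≤
      ∑ s ∈ Finset.Ico C t, if Unsettled ξ ord w d μ Δ n s then 1 else 0 := by
  induction t with
  | zero => simp [run, UserState.start]
  | succ t ih =>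
    by_cases ht : t < C
    · have := (run_of_le ξ ord w d (t := t + 1) ht j).1
      omega
    · rw [not_lt] at ht
      rw [Finset.sum_Ico_succ_top ht]
      have hover' : ¬ Over (run ξ ord w d t) := fun h => hover (over_succ h)
      by_cases hne : (run ξ ord w d (t + 1) j).estimate = (run ξ ord w d t j).estimate
      · have hj' := hne.symm.trans hj
        have h1 := ih hj' hover'
        rw [run_succ] at hne ⊢
        rw [slot_eq_untested ht hne]
        refine sum_untested_collisions_le.trans ?_
        gcongr
        split_ifs with h2 h3
        · exact le_rfl
        · exact absurd h2 (not_shared_of_not_unsettled hover' h3 hj')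
        all_goals simp
      · rw [run_succ] at hne ⊢
        rw [(slot_of_estimate_ne ht hne).2]
        simp

open Classical in
/-- When over-estimation happens, the threshold has been exceeded by the unsettled slots. -/
lemma threshold_lt_of_over (hU : 2 ≤ U) (hover : Over (run ξ ord w d n)) :
    ξ U < ((∑ s ∈ Finset.Ico C n, if Unsettled ξ ord w d μ Δ n s then 1 else 0 : ℕ) : ℝ) := by
  suffices h : ∀ t ≤ n, Over (run ξ ord w d t) → ξ U <
      ((∑ s ∈ Finset.Ico C t, if Unsettled ξ ord w d μ Δ n s then 1 else 0 : ℕ) : ℝ) from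
    h n le_rfl hover
  intro t
  induction t with
  | zero =>
    rintro - ⟨j, hj⟩
    have : (run ξ ord w d 0 j).estimate = 1 := rfl
    omega
  | succ t ih =>
    intro htn ho
    by_cases ht : t < C
    · obtain ⟨j, hj⟩ := ho
      have := (run_of_le ξ ord w d (t := t + 1) ht j).1
      omega
    · rw [not_lt] at ht
      rw [Finset.sum_Ico_succ_top ht]
      by_cases ho' : Over (run ξ ord w d t)
      · refine (ih (by omega) ho').trans_le ?_
        push_cast
        split_ifs <;> simp
      · obtain ⟨j, hj⟩ := ho
        have hle : (run ξ ord w d t j).estimate ≤ U := by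
          by_contra! h; exact ho' ⟨j, h⟩
        have hne : (run ξ ord w d (t + 1) j).estimate ≠ (run ξ ord w d t j).estimate := by omega
        -- The slot that raises the estimate is itself disrupted, which pays for a collision
        -- recorded in it.
        have hun : Unsettled ξ ord w d μ Δ n t :=
          ⟨ho', Or.inl (Or.inr (Or.inr (Or.inr ⟨j, hne⟩)))⟩
        have heq : (run ξ ord w d t j).estimate = U := by
          rw [run_succ] at hj
          rcases slot_estimate ξ ord t (run ξ ord w d t) (fun i => w i (t + 1))
            (fun j => d j (t + 1)) j with h | h <;> omega
        rw [run_succ] at hne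
        have h1 := (slot_of_estimate_ne ht hne).1
        rw [heq] at h1
        refine h1.trans_le ?_
        rw [if_pos hun]
        have h2 := sum_collisions_le (μ := μ) (Δ := Δ) (n := n) hU heq ho'
        have h3 := collisionCount_le (untested ord t (run ξ ord w d t) (fun i => w i (t + 1))
          (fun j => d j (t + 1)) j) (t + 1) U
        have h4 := sum_untested_collisions_le (ord := ord) (t := t) (S := run ξ ord w d t)
          (w := fun i => w i (t + 1)) (d := fun j => d j (t + 1)) (j := j)
        have h5 : (if Shared (sensedChannel ord t (run ξ ord w d t) fun j => d j (t + 1)) j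
          then 1 else 0) ≤ 1 := by split_ifs <;> simp
        exact_mod_cast h3.trans (h4.trans (by omega))

end Trajectory

/-! ### Distance to the frozen configurations, and weights -/

section Potential

/-- The distance of a configuration from the frozen ones. -/
noncomputable def dist (pos : Fin C → Fin C) (x : Config U C) : ℕ := sInf {k | Near pos k x}

lemma near_dist {pos : Fin C → Fin C} {x : Config U C} {k : ℕ} (h : Near pos k x) :
    Near pos (dist pos x) x := Nat.sInf_mem (s := {k | Near pos k x}) ⟨k, h⟩

lemma dist_le {pos : Fin C → Fin C} {x : Config U C} {k : ℕ} (h : Near pos k x) :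
    dist pos x ≤ k := Nat.sInf_le h

open Classical in
/-- A successor of `x` that is closer to the frozen configurations, if there is one. -/
noncomputable def next (pos : Fin C → Fin C) (x : Config U C) : Config U C :=
  if h : ∃ y, Step pos x y ∧ Near pos (dist pos x - 1) y then h.choose else x

lemma next_spec {pos : Fin C → Fin C} {x : Config U C} {k : ℕ} (h : Near pos k x)
    (h0 : ¬ Near pos 0 x) : Step pos x (next pos x) ∧ Near pos (dist pos x - 1) (next pos x) := by
  have hd := near_dist h
  have hex : ∃ y, Step pos x y ∧ Near pos (dist pos x - 1) y := by
    obtain ⟨m, hm⟩ : ∃ m, dist pos x = m + 1 := by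
      refine Nat.exists_eq_succ_of_ne_zero fun h => h0 ?_
      rwa [h] at hd
    rw [hm] at hd ⊢
    rcases hd with hd | hd
    · have := dist_le hd
      omega
    · exact hd
  rw [next, dif_pos hex]
  exact hex.choose_spec

/-- The weights `u 0 = 0`, `u (k + 1) = Q (u k + 1)`. -/
def weight (Q : ℕ) : ℕ → ℕ
  | 0 => 0
  | k + 1 => Q * (weight Q k + 1)

lemma weight_mono {Q : ℕ} (hQ : 1 ≤ Q) : Monotone (weight Q) := by
  refine monotone_nat_of_le_succ fun k => ?_
  change _ ≤ Q * (weight Q k + 1)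
  nlinarith

end Potential

/-! ### Pathwise drift inequality for the Lyapunov function -/

section Drift

variable [NeZero C] (ξ : ℕ → ℝ) (ord : Fin U → Equiv.Perm (Fin C)) (w : Fin C → ℕ → ℕ)
  (d : Fin U → ℕ → ℕ → ℕ) (μ : Fin C → ℝ) (Δ : ℝ) (n M Q t : ℕ)

/-- Slot `t + 1` is disrupted before over-estimation. -/
def Broken : Prop := ¬ Over (run ξ ord w d t) ∧ RunDisrupted ξ ord w d μ Δ n t

/-- Slot `t + 1` is undisrupted, before over-estimation, and not frozen. -/
def Active : Prop := ¬ Over (run ξ ord w d t) ∧ ¬ RunDisrupted ξ ord w d μ Δ n t ∧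
  ¬ Near (position μ) 0 (runConfig ξ ord w d t)

/-- The ranks to be drawn in slot `t + 2` in order to approach the frozen configurations. -/
noncomputable def aim (j : Fin U) : ℕ :=
  targetRank Δ n (t + 1) (run ξ ord w d (t + 1) j)
    ((next (position μ) (runConfig ξ ord w d t)).2.1 j)

/-- In slot `t + 2` all channels are free and the draws are those aimed at. -/
def Hit : Prop := (∀ i, w i (t + 1 + 1) = 1) ∧
  ∀ j, d j (t + 1 + 1) (run ξ ord w d (t + 1) j).estimate = aim ξ ord w d μ Δ n t j

open Classical in
/-- The Lyapunov function. -/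
noncomputable def energy : ℕ :=
  if Over (run ξ ord w d t) then 0
  else if RunDisrupted ξ ord w d μ Δ n t then weight Q M + 1
  else weight Q M - weight Q (M - dist (position μ) (runConfig ξ ord w d t))

open Classical in
/-- The amount by which the Lyapunov function is below its maximum in an active slot. -/
noncomputable def gain : ℕ :=
  if Active ξ ord w d μ Δ n t then
    weight Q (M - dist (position μ) (runConfig ξ ord w d t)) else 0

variable {ξ ord w d μ Δ n M Q t}

lemma energy_le : energy ξ ord w d μ Δ n M Q t ≤ weight Q M + 1 := by
  unfold energy
  split_ifs <;> omega

open Classical in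
lemma unsettled_indicator : (if Unsettled ξ ord w d μ Δ n t then 1 else 0) =
    (if Active ξ ord w d μ Δ n t then 1 else 0) + if Broken ξ ord w d μ Δ n t then 1 else 0 := by
  unfold Unsettled Active Broken
  by_cases h1 : Over (run ξ ord w d t) <;> by_cases h2 : RunDisrupted ξ ord w d μ Δ n t <;>
    simp [h1, h2]

open Classical in
-- In an active slot at distance `δ`, energy plus gain is exactly `weight Q M`. After a hit and
-- without disruption the next energy is at most `weight Q M - weight Q (M - δ + 1)`, and the
-- recursion makes the hit term equal `weight Q (M - δ + 1)`. Frozen slots have energy zero and stay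
-- frozen until disrupted; a disruption in the next slot is paid for by the last term. Once hits
-- have conditional probability at least `1 / Q`, the gains cancel in expectation and leave one unit
-- per active slot.
lemma energy_drift (hΔ : 0 < Δ) (hgap : ∀ x y, x ≠ y → Δ ≤ |μ x - μ y|)
    (hUC : U ≤ C) (hd : ∀ j k u, 1 ≤ u → d j k u ∈ Finset.Icc 1 u) (ht : C ≤ t) (htn : t < n)
    (hQ : 1 ≤ Q) (hM : ∀ x : Config U C, x.Valid (position μ) → Near (position μ) M x) :
    energy ξ ord w d μ Δ n M Q (t + 1) +
        (if Hit ξ ord w d μ Δ n t then Q * (gain ξ ord w d μ Δ n M Q t +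
          if Active ξ ord w d μ Δ n t then 1 else 0) else 0) +
        (if Broken ξ ord w d μ Δ n t then 1 else 0) ≤
      energy ξ ord w d μ Δ n M Q t + gain ξ ord w d μ Δ n M Q t +
        (weight Q M + 1) * (if Broken ξ ord w d μ Δ n (t + 1) then 1 else 0) := by
  have hmono := weight_mono hQ
  by_cases hover : Over (run ξ ord w d t)
  · simp [energy, gain, Active, Broken, hover, over_succ hover]
  by_cases hdis : RunDisrupted ξ ord w d μ Δ n t
  · simp only [energy, gain, Active, Broken, hover, hdis]
    by_cases hover' : Over (run ξ ord w d (t + 1)) <;>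
      by_cases hdis' : RunDisrupted ξ ord w d μ Δ n (t + 1) <;> simp [hover', hdis']
  have hover' : ¬ Over (run ξ ord w d (t + 1)) := by
    rintro ⟨j, hj⟩
    exact hover ⟨j, by rwa [← estimate_eq_of_not_disrupted hdis]⟩
  have hnear := hM _ (runConfig_valid hΔ hgap hUC hd ht htn.le hover hdis)
  have hnear' := fun hdis' =>
    hM _ (runConfig_valid hΔ hgap hUC hd (ht.trans t.le_succ) htn hover' hdis')
  by_cases hfr : Near (position μ) 0 (runConfig ξ ord w d t)
  · by_cases hdis' : RunDisrupted ξ ord w d μ Δ n (t + 1)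
    · simp [energy, gain, Active, Broken, hover, hdis, hover', hdis', hfr]
    · have := dist_le (frozen_succ hΔ hgap hUC hd ht htn hover' hdis hdis' hfr)
      simp only [nonpos_iff_eq_zero] at this
      simp [energy, gain, Active, Broken, hover, hdis, hover', hdis', hfr, this]
  · have hact : Active ξ ord w d μ Δ n t := ⟨hover, hdis, hfr⟩
    obtain ⟨hstep, hnext⟩ := next_spec hnear hfr
    have hpos : dist (position μ) (runConfig ξ ord w d t) ≠ 0 := fun h => hfr (by
      have := near_dist hnear
      rwa [h] at this)
    have hle := dist_le hnear
    set δ := dist (position μ) (runConfig ξ ord w d t) with hδ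
    have hw : Q * (weight Q (M - δ) + 1) = weight Q (M - (δ - 1)) := by
      rw [show M - (δ - 1) = (M - δ) + 1 by omega]
      rfl
    have h1 : weight Q (M - (δ - 1)) ≤ weight Q M := hmono (by omega)
    have h2 : weight Q (M - δ) ≤ weight Q M := hmono (by omega)
    simp only [energy, gain, hact, Broken, hover, hdis, hover', if_true, if_false, ← hδ, hw]
    by_cases hdis' : RunDisrupted ξ ord w d μ Δ n (t + 1)
    · simp only [hdis', if_true]
      split_ifs <;> simp_all; omega
    · by_cases hhit : Hit ξ ord w d μ Δ n t
      · have hc := runConfig_succ_of_step hΔ hgap ht htn hdis hdis' hstep hhit.1 hhit.2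
        rw [← hc] at hnext
        have h3 := dist_le hnext
        have h4 : weight Q (M - (δ - 1)) ≤
            weight Q (M - dist (position μ) (runConfig ξ ord w d (t + 1))) := hmono (by omega)
        have h5 : weight Q (M - dist (position μ) (runConfig ξ ord w d (t + 1))) ≤ weight Q M :=
          hmono (by omega)
        simp [hdis', hhit]
        omega
      · simp [hdis', hhit]
        omega

end Drift

/-! ### Counting disrupted slots -/

section Count

variable [NeZero C] (ξ : ℕ → ℝ) (ord : Fin U → Equiv.Perm (Fin C)) (w : Fin C → ℕ → ℕ)
  (d : Fin U → ℕ → ℕ → ℕ)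

/-- Truncated sensing counts plus truncated estimates. -/
noncomputable def progress (ℓ t : ℕ) : ℕ :=
  ∑ j, ((∑ i, min ((run ξ ord w d t j).sensed i) ℓ) + min (run ξ ord w d t j).estimate (U + 1))

variable {ξ ord w d} {μ : Fin C → ℝ} {Δ : ℝ} {n t ℓ K : ℕ}

lemma progress_le : progress ξ ord w d ℓ t ≤ U * (C * ℓ + (U + 1)) := by
  refine (Finset.sum_le_card_nsmul _ _ (C * ℓ + (U + 1)) fun j _ => ?_).trans_eq (by simp)
  gcongr
  · exact (Finset.sum_le_card_nsmul _ _ ℓ fun i _ => min_le_right _ _).trans_eq (by simp)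
  · exact min_le_right _ _

lemma progress_mono : progress ξ ord w d ℓ t ≤ progress ξ ord w d ℓ (t + 1) := by
  unfold progress
  gcongr with j _ i _
  · exact run_sensed_mono ..
  · exact run_estimate_mono ..

lemma progress_lt_of_sensed {j : Fin U}
    (h : (run ξ ord w d t j).sensed (channels ξ ord w d t j) < ℓ) :
    progress ξ ord w d ℓ t < progress ξ ord w d ℓ (t + 1) := by
  unfold progress
  refine Finset.sum_lt_sum (fun k _ => ?_) ⟨j, Finset.mem_univ _, ?_⟩
  · gcongr with i _
    · exact run_sensed_mono ..
    · exact run_estimate_mono ..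
  · refine add_lt_add_of_lt_of_le (Finset.sum_lt_sum (fun i _ => ?_)
      ⟨channels ξ ord w d t j, Finset.mem_univ _, ?_⟩) ?_
    · gcongr; exact run_sensed_mono ..
    · rw [run_succ, slot_sensed]
      change min ((run ξ ord w d t j).sensed (channels ξ ord w d t j)) ℓ <
        min (Function.update (run ξ ord w d t j).sensed (channels ξ ord w d t j)
          ((run ξ ord w d t j).sensed (channels ξ ord w d t j) + 1) (channels ξ ord w d t j)) ℓ
      rw [Function.update_self]
      omega
    · gcongr; exact run_estimate_mono ..

lemma progress_lt_of_estimate {j : Fin U}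
    (h : (run ξ ord w d (t + 1) j).estimate ≠ (run ξ ord w d t j).estimate)
    (hover : ¬ Over (run ξ ord w d t)) :
    progress ξ ord w d ℓ t < progress ξ ord w d ℓ (t + 1) := by
  unfold progress
  refine Finset.sum_lt_sum (fun k _ => ?_) ⟨j, Finset.mem_univ _, ?_⟩
  · gcongr with i _
    · exact run_sensed_mono ..
    · exact run_estimate_mono ..
  · refine add_lt_add_of_le_of_lt (Finset.sum_le_sum fun i _ => ?_) ?_
    · gcongr; exact run_sensed_mono ..
    · have h1 : (run ξ ord w d t j).estimate ≤ U := by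
        by_contra! h; exact hover ⟨j, h⟩
      have h2 := run_estimate_mono ξ ord w d t j
      omega

open Classical in
/-- The number of disrupted slots is at most the number of slots with inaccurate statistics, up to
a bound that is linear in `ℓ`. -/
lemma sum_broken_le (hℓ : ∀ T : ℕ, Δ ^ 2 * T ≤ 32 * Real.log n → T < ℓ)
    (hK : ∀ t : ℕ, Δ ^ 2 * t ≤ 8 → t < K) (m : ℕ) :
    ∑ t ∈ Finset.Ico C m, (if Broken ξ ord w d μ Δ n t then 1 else 0) ≤
      K + U * (C * ℓ + (U + 1)) +
        ∑ t ∈ Finset.Ico C m, if ¬ Concentrated μ t (run ξ ord w d t) then 1 else 0 := by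
  -- Unless early or inaccurate, a disrupted slot before over-estimation raises `progress`: some
  -- sensed channel has count below `ℓ`, or some estimate of at most `U` increases.
  have hstep : ∀ t, (if Broken ξ ord w d μ Δ n t then 1 else 0) + progress ξ ord w d ℓ t ≤
      (if t < K then 1 else 0) + (if ¬ Concentrated μ t (run ξ ord w d t) then 1 else 0) +
        progress ξ ord w d ℓ (t + 1) := by
    intro t
    have hmono : progress ξ ord w d ℓ t ≤ progress ξ ord w d ℓ (t + 1) := progress_mono
    by_cases hb : Broken ξ ord w d μ Δ n t
    · rw [if_pos hb]
      obtain ⟨hover, h | h | ⟨j, h⟩ | ⟨j, h⟩⟩ := hb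
      · rw [if_pos (hK t h)]; omega
      · rw [if_pos h]; omega
      · have := progress_lt_of_sensed (hℓ _ (not_lt.1 h))
        omega
      · have := progress_lt_of_estimate (ℓ := ℓ) h hover
        omega
    · rw [if_neg hb]; omega
  have hsum : ∀ m, (∑ t ∈ Finset.Ico C m, if Broken ξ ord w d μ Δ n t then 1 else 0) ≤
      (∑ t ∈ Finset.Ico C m, if t < K then 1 else 0) +
      (∑ t ∈ Finset.Ico C m, if ¬ Concentrated μ t (run ξ ord w d t) then 1 else 0) +
        progress ξ ord w d ℓ m := by
    intro m
    induction m with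
    | zero => simp
    | succ m ih =>
      by_cases hm : C ≤ m
      · simp only [Finset.sum_Ico_succ_top hm]
        have := hstep m
        omega
      · rw [Finset.Ico_eq_empty (by omega)]; simp
  have h1 : (∑ t ∈ Finset.Ico C m, if t < K then 1 else 0) ≤ K := by
    rw [← Finset.card_filter]
    refine (Finset.card_le_card (t := Finset.range K) fun t ht => ?_).trans_eq (by simp)
    simpa using (Finset.mem_filter.1 ht).2
  have h2 := hsum m
  have h3 : progress ξ ord w d ℓ m ≤ U * (C * ℓ + (U + 1)) := progress_le
  omega

end Count

/-! ### Measurability of the run and the information in its slots -/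

section Measurability

instance : MeasurableSpace (UserState C) := ⊤

instance : DiscreteMeasurableSpace (UserState C) := ⟨fun _ => trivial⟩

instance : Countable (UserState C) :=
  Function.Injective.countable (f := fun s : UserState C =>
    (s.sensed, s.free, s.estimate, s.rank, s.collisions, s.collided)) <| by
    rintro ⟨⟩ ⟨⟩ h
    simp only [Prod.mk.injEq] at h
    simp [h]

/-- Memories form a countable space, so they may be treated as constant when a slot is shown to be
measurable. -/
lemma measurable_apply_of_countable {Ω β γ : Type*} {m : MeasurableSpace Ω} [Countable β]
    [MeasurableSpace β] [MeasurableSingletonClass β] [MeasurableSpace γ] {Y : Ω → β}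
    (hY : Measurable Y) {F : β → Ω → γ} (hF : ∀ y, Measurable (F y)) :
    Measurable fun ω => F (Y ω) ω := by
  intro s hs
  have : (fun ω => F (Y ω) ω) ⁻¹' s = ⋃ y, Y ⁻¹' {y} ∩ F y ⁻¹' s := by
    ext ω
    simp
  rw [this]
  exact MeasurableSet.iUnion fun y => (hY (measurableSet_singleton y)).inter (hF y hs)

/-- Indices of the availabilities and of the draws. -/
abbrev Index (U C : ℕ) := (Fin C × ℕ) ⊕ (Fin U × ℕ × ℕ)

/-- The slot of a random variable. -/
def Index.time : Index U C → ℕ := Sum.elim (fun p => p.2) (fun q => q.2.1)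

variable {Ω : Type*} (W : Fin C → ℕ → Ω → ℕ) (D : Fin U → ℕ → ℕ → Ω → ℕ)

/-- All availabilities and draws. -/
def source : Index U C → Ω → ℕ :=
  Sum.elim (fun p : Fin C × ℕ => W p.1 p.2) (fun q : Fin U × ℕ × ℕ => D q.1 q.2.1 q.2.2)

/-- The σ-algebra generated by the random variables with index in `I`. -/
abbrev info (I : Set (Index U C)) : MeasurableSpace Ω :=
  ⨆ i ∈ I, MeasurableSpace.comap (source W D i) inferInstance

/-- Indices of the slots up to `t`. -/
def past (U C t : ℕ) : Set (Index U C) := {x | x.time ≤ t}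

/-- Indices of the slots up to `t` and of the draws of slot `t + 1`. -/
def pastDraws (U C t : ℕ) : Set (Index U C) :=
  past U C t ∪ Set.range fun q : Fin U × ℕ => Sum.inr (q.1, t + 1, q.2)

variable {W D}

lemma info_mono {I J : Set (Index U C)} (h : I ⊆ J) : info W D I ≤ info W D J :=
  biSup_mono h

lemma measurable_source {I : Set (Index U C)} {x : Index U C} (hx : x ∈ I) :
    Measurable[info W D I] (source W D x) :=
  (comap_measurable _).mono (le_biSup (fun i => MeasurableSpace.comap (source W D i) _) hx) le_rfl

lemma info_le [MeasurableSpace Ω] (hW : ∀ i k, Measurable (W i k)) (hD : ∀ j k u, Measurable (D j k u))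
    (I : Set (Index U C)) : info W D I ≤ ‹MeasurableSpace Ω› := by
  refine iSup₂_le fun x _ => ?_
  rcases x with p | q
  · exact (hW p.1 p.2).comap_le
  · exact (hD q.1 q.2.1 q.2.2).comap_le

lemma indep_info [MeasurableSpace Ω] {P : Measure Ω} (hW : ∀ i k, Measurable (W i k)) (hD : ∀ j k u, Measurable (D j k u))
    (h_indep : iIndepFun (source W D) P) {I J : Set (Index U C)} (h : Disjoint I J) :
    Indep (info W D I) (info W D J) P := by
  refine indep_iSup_of_disjoint (fun x => ?_) h_indep h
  rcases x with p | q
  · exact (hW p.1 p.2).comap_le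
  · exact (hD q.1 q.2.1 q.2.2).comap_le

lemma past_subset_pastDraws (t : ℕ) : past U C t ⊆ pastDraws U C t := Set.subset_union_left

lemma pastDraws_subset_past (t : ℕ) : pastDraws U C t ⊆ past U C (t + 1) := by
  rintro x (hx | ⟨q, rfl⟩)
  · exact Nat.le_succ_of_le hx
  · exact Nat.le_refl (t + 1)

variable [NeZero C] (ξ : ℕ → ℝ) (ord : Fin U → Equiv.Perm (Fin C))

/-- Only the draw at the current estimate matters: for given memories, finitely many variables
replace the infinite family of draws of the slot. -/
lemma sensedChannel_congr (t : ℕ) (S : Fin U → UserState C) (d : Fin U → ℕ → ℕ) :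
    sensedChannel ord t S d = sensedChannel ord t S fun j _ => d j (S j).estimate := rfl

lemma slot_congr (t : ℕ) (S : Fin U → UserState C) (w : Fin C → ℕ) (d : Fin U → ℕ → ℕ) :
    slot ξ ord t S w d = slot ξ ord t S w fun j _ => d j (S j).estimate := rfl

lemma measurable_slot {m : MeasurableSpace Ω} {S : Ω → Fin U → UserState C} (hS : Measurable S)
    {w : Fin C → Ω → ℕ} (hw : ∀ i, Measurable (w i)) {d : Fin U → ℕ → Ω → ℕ}
    (hd : ∀ j u, Measurable (d j u)) (t : ℕ) :
    Measurable fun ω => slot ξ ord t (S ω) (fun i => w i ω) fun j u => d j u ω := by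
  refine measurable_apply_of_countable hS
    (F := fun S ω => slot ξ ord t S (fun i => w i ω) fun j u => d j u ω) fun S => ?_
  have h : Measurable fun ω => ((fun i => w i ω, fun j => d j (S j).estimate ω) :
      (Fin C → ℕ) × (Fin U → ℕ)) :=
    (measurable_pi_lambda _ hw).prodMk (measurable_pi_lambda _ fun j => hd j _)
  have hF : Measurable fun p : (Fin C → ℕ) × (Fin U → ℕ) =>
    slot ξ ord t S p.1 fun j _ => p.2 j := Measurable.of_discrete
  have heq : (fun ω => slot ξ ord t S (fun i => w i ω) fun j u => d j u ω) =
      (fun p : (Fin C → ℕ) × (Fin U → ℕ) => slot ξ ord t S p.1 fun j _ => p.2 j) ∘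
        fun ω => (fun i => w i ω, fun j => d j (S j).estimate ω) :=
    funext fun ω => slot_congr ξ ord t S _ _
  rw [heq]
  exact hF.comp h

lemma measurable_sensedChannel {m : MeasurableSpace Ω} {S : Ω → Fin U → UserState C}
    (hS : Measurable S) {d : Fin U → ℕ → Ω → ℕ} (hd : ∀ j u, Measurable (d j u)) (t : ℕ) :
    Measurable fun ω => sensedChannel ord t (S ω) fun j u => d j u ω := by
  refine measurable_apply_of_countable hS
    (F := fun S ω => sensedChannel ord t S fun j u => d j u ω) fun S => ?_
  simp_rw [sensedChannel_congr ord t S]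
  have h : Measurable fun ω => (fun j => d j (S j).estimate ω : Fin U → ℕ) :=
    measurable_pi_lambda _ fun j => hd j _
  exact (Measurable.of_discrete (f := fun p : Fin U → ℕ =>
    sensedChannel ord t S fun j _ => p j)).comp h

lemma measurable_run (t : ℕ) : Measurable[info W D (past U C t)]
    fun ω => run ξ ord (fun i k => W i k ω) (fun j k u => D j k u ω) t := by
  induction t with
  | zero => exact measurable_const
  | succ t ih =>
    exact measurable_slot (m := info W D (past U C (t + 1))) ξ ord
      (ih.mono (info_mono ((past_subset_pastDraws t).trans (pastDraws_subset_past t))) le_rfl)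
      (w := fun i => W i (t + 1)) (d := fun j => D j (t + 1))
      (fun i => measurable_source (x := Sum.inl (i, t + 1)) (Nat.le_refl (t + 1)))
      (fun j u => measurable_source (x := Sum.inr (j, t + 1, u)) (Nat.le_refl (t + 1))) t

/-- Channels are chosen before the availabilities of the slot are seen; hence `pastDraws`, which is
independent of those availabilities. -/
lemma measurable_channels (t : ℕ) : Measurable[info W D (pastDraws U C t)]
    fun ω => channels ξ ord (fun i k => W i k ω) (fun j k u => D j k u ω) t :=
  measurable_sensedChannel (m := info W D (pastDraws U C t)) ord
    ((measurable_run ξ ord t).mono (info_mono (past_subset_pastDraws t)) le_rfl)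
    (d := fun j => D j (t + 1))
    (fun j u => measurable_source (x := Sum.inr (j, t + 1, u)) (Or.inr ⟨(j, u), rfl⟩)) t

/-- A possible record of a slot: memories before it, sensed channels, memories after it. -/
abbrev Record (U C : ℕ) := (Fin U → UserState C) × (Fin U → Fin C) × (Fin U → UserState C)

lemma measurable_comp_record {γ : Type*} [MeasurableSpace γ] (t : ℕ) (f : Record U C → γ) :
    Measurable[info W D (past U C (t + 1))] fun ω =>
      f (run ξ ord (fun i k => W i k ω) (fun j k u => D j k u ω) t,
        channels ξ ord (fun i k => W i k ω) (fun j k u => D j k u ω) t,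
        run ξ ord (fun i k => W i k ω) (fun j k u => D j k u ω) (t + 1)) := by
  refine (Measurable.of_discrete (f := f)).comp
    (Measurable.prodMk ?_ (Measurable.prodMk ?_ (measurable_run ξ ord (t + 1))))
  · exact (measurable_run ξ ord t).mono
      (info_mono ((past_subset_pastDraws t).trans (pastDraws_subset_past t))) le_rfl
  · exact (measurable_channels ξ ord t).mono (info_mono (pastDraws_subset_past t)) le_rfl

variable (μ : Fin C → ℝ) (Δ : ℝ) (n M Q t : ℕ)

lemma measurableSet_broken : MeasurableSet[info W D (past U C (t + 1))]
    {ω | Broken ξ ord (fun i k => W i k ω) (fun j k u => D j k u ω) μ Δ n t} :=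
  measurable_comp_record ξ ord t (fun y => ¬ Over y.1 ∧ Disrupted μ Δ n t y.1 y.2.1 y.2.2)
    (MeasurableSet.of_discrete (s := {p | p}))

lemma measurableSet_active : MeasurableSet[info W D (past U C (t + 1))]
    {ω | Active ξ ord (fun i k => W i k ω) (fun j k u => D j k u ω) μ Δ n t} :=
  measurable_comp_record ξ ord t (fun y => ¬ Over y.1 ∧ ¬ Disrupted μ Δ n t y.1 y.2.1 y.2.2 ∧
    ¬ Near (position μ) 0 (config y.1 y.2.1 y.2.2)) (MeasurableSet.of_discrete (s := {p | p}))

lemma measurable_gain : Measurable[info W D (past U C (t + 1))]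
    fun ω => gain ξ ord (fun i k => W i k ω) (fun j k u => D j k u ω) μ Δ n M Q t :=
  Measurable.ite (measurableSet_active ξ ord μ Δ n t)
    (measurable_comp_record ξ ord t fun y =>
      weight Q (M - dist (position μ) (config y.1 y.2.1 y.2.2))) measurable_const

lemma measurable_energy : Measurable[info W D (past U C (t + 1))]
    fun ω => energy ξ ord (fun i k => W i k ω) (fun j k u => D j k u ω) μ Δ n M Q t := by
  have h1 : MeasurableSet[info W D (past U C (t + 1))]
      {ω | Over (run ξ ord (fun i k => W i k ω) (fun j k u => D j k u ω) t)} :=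
    measurable_comp_record ξ ord t (fun y => Over y.1) (MeasurableSet.of_discrete (s := {p | p}))
  have h2 : MeasurableSet[info W D (past U C (t + 1))]
      {ω | RunDisrupted ξ ord (fun i k => W i k ω) (fun j k u => D j k u ω) μ Δ n t} :=
    measurable_comp_record ξ ord t (fun y => Disrupted μ Δ n t y.1 y.2.1 y.2.2)
      (MeasurableSet.of_discrete (s := {p | p}))
  exact Measurable.ite h1 measurable_const (Measurable.ite h2 measurable_const
    (measurable_comp_record ξ ord t fun y =>
      weight Q M - weight Q (M - dist (position μ) (config y.1 y.2.1 y.2.2))))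

/-- The estimates after slot `t + 1` together with the ranks aimed at. -/
lemma measurable_aim : Measurable[info W D (past U C (t + 1))] fun ω =>
    ((fun j => (run ξ ord (fun i k => W i k ω) (fun j k u => D j k u ω) (t + 1) j).estimate,
      fun j => aim ξ ord (fun i k => W i k ω) (fun j k u => D j k u ω) μ Δ n t j) :
      (Fin U → ℕ) × (Fin U → ℕ)) :=
  measurable_comp_record ξ ord t fun y => ((fun j => (y.2.2 j).estimate,
    fun j => targetRank Δ n (t + 1) (y.2.2 j)
      ((next (position μ) (config y.1 y.2.1 y.2.2)).2.1 j)) : (Fin U → ℕ) × (Fin U → ℕ))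

end Measurability

/-! ### Concentration of sample means under adaptive sensing -/

section Concentration

variable {Ω : Type*} [MeasurableSpace Ω] {P : Measure Ω} [IsProbabilityMeasure P]

/-- Hoeffding's lemma for a Bernoulli variable. -/
lemma lintegral_exp_le_one {X : Ω → ℕ} (hX : Measurable X) {m : ℝ} (hm : 0 ≤ m)
    (h1 : P {ω | X ω = 1} = ENNReal.ofReal m) (h01 : ∀ᵐ ω ∂P, X ω = 0 ∨ X ω = 1) (l : ℝ) :
    ∫⁻ ω, ENNReal.ofReal (Real.exp (l * (X ω - m) - l ^ 2 / 8)) ∂P ≤ 1 := by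
  have hmean : ∫ ω, (X ω : ℝ) ∂P = m := by
    have : (fun ω => (X ω : ℝ)) =ᵐ[P] {ω | X ω = 1}.indicator fun _ => 1 := by
      filter_upwards [h01] with ω hω
      rcases hω with h | h <;> simp [Set.indicator, h]
    have hset : MeasurableSet {ω | X ω = 1} := hX (measurableSet_singleton 1)
    rw [integral_congr_ae this, integral_indicator hset]
    simp [Measure.real, h1, hm]
  have hsub := hasSubgaussianMGF_of_mem_Icc (μ := P) (X := fun ω => (X ω : ℝ)) (a := 0) (b := 1)
    (Measurable.aemeasurable (by fun_prop)) (by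
      filter_upwards [h01] with ω hω
      rcases hω with h | h <;> simp [h])
  rw [hmean] at hsub
  have hle := hsub.mgf_le l
  have hint := hsub.integrable_exp_mul l
  simp only [Real.exp_sub]
  rw [← ofReal_integral_eq_lintegral_ofReal (hint.div_const _)
    (Eventually.of_forall fun ω => by positivity), integral_div]
  refine ENNReal.ofReal_le_one.2 ?_
  rw [div_le_one (Real.exp_pos _)]
  refine hle.trans (Real.exp_le_exp.2 (le_of_eq ?_))
  simp
  ring

/-- The exponential supermartingale of the observations of one channel. -/
noncomputable def expWeight (l m : ℝ) (s : UserState C) (i : Fin C) : ENNReal :=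
  ENNReal.ofReal (Real.exp (l * (s.free i - m * s.sensed i) - s.sensed i * (l ^ 2 / 8)))

/-- For a radius `a` with `a ^ 2 * T = 2 * log t`, the exponent `l * a * T - T * l ^ 2 / 8` is
maximal at `l = 4 * a`, with value `2 * a ^ 2 * T = 4 * log t`. -/
lemma le_expWeight {s : UserState C} {i : Fin C} {m : ℝ} {t : ℕ} (ht : 1 ≤ t)
    (hT : 1 ≤ s.sensed i)
    (h : Real.sqrt (2 * Real.log t / (s.sensed i : ℝ)) <
      |(s.free i : ℝ) / (s.sensed i : ℝ) - m|) :
    ENNReal.ofReal ((t : ℝ) ^ 4) ≤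
        expWeight (4 * Real.sqrt (2 * Real.log t / (s.sensed i : ℝ))) m s i ∨
      ENNReal.ofReal ((t : ℝ) ^ 4) ≤
        expWeight (-(4 * Real.sqrt (2 * Real.log t / (s.sensed i : ℝ)))) m s i := by
  have hT' : (0 : ℝ) < s.sensed i := by exact_mod_cast hT
  have ht' : (0 : ℝ) < t := by exact_mod_cast ht
  set a := Real.sqrt (2 * Real.log t / (s.sensed i : ℝ)) with ha
  have ha0 : 0 ≤ a := Real.sqrt_nonneg _
  have hsq : a ^ 2 * s.sensed i = 2 * Real.log t := by
    rw [ha, Real.sq_sqrt (div_nonneg (mul_nonneg zero_le_two (Real.log_natCast_nonneg t)) hT'.le),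
      div_mul_cancel₀ _ hT'.ne']
  have hpow : (t : ℝ) ^ 4 = Real.exp (4 * Real.log t) := by
    rw [mul_comm, Real.exp_mul, Real.exp_log ht']
    norm_cast
  have hfr : (s.free i : ℝ) - m * s.sensed i =
      ((s.free i : ℝ) / (s.sensed i : ℝ) - m) * s.sensed i := by field_simp
  rw [hpow]
  unfold expWeight
  rw [hfr]
  set z := (s.free i : ℝ) / (s.sensed i : ℝ) - m with hz
  rcases lt_abs.1 h with h | h
  · refine Or.inl (ENNReal.ofReal_le_ofReal (Real.exp_le_exp.2 ?_))
    have : a * a * s.sensed i ≤ a * z * s.sensed i := by gcongr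
    nlinarith
  · refine Or.inr (ENNReal.ofReal_le_ofReal (Real.exp_le_exp.2 ?_))
    have : a * a * s.sensed i ≤ a * (-z) * s.sensed i := by gcongr
    nlinarith

variable {W : Fin C → ℕ → Ω → ℕ} {D : Fin U → ℕ → ℕ → Ω → ℕ} [NeZero C]

/-- The weight changes only when user `j` senses channel `i`. It is then multiplied by a factor
independent of the past and of the choice of channel, of mean at most one by Hoeffding's lemma. -/
lemma lintegral_expWeight_le_one (hW : ∀ i k, Measurable (W i k))
    (hD : ∀ j k u, Measurable (D j k u)) (h_indep : iIndepFun (source W D) P)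
    {μ : Fin C → ℝ} (hμ : ∀ i, 0 ≤ μ i)
    (h1 : ∀ i k, P {ω | W i k ω = 1} = ENNReal.ofReal (μ i))
    (h01 : ∀ i k, ∀ᵐ ω ∂P, W i k ω = 0 ∨ W i k ω = 1)
    (ξ : ℕ → ℝ) (ord : Fin U → Equiv.Perm (Fin C)) (j : Fin U) (i : Fin C) (l : ℝ) (t : ℕ) :
    ∫⁻ ω, expWeight l (μ i)
      (run ξ ord (fun i k => W i k ω) (fun j k u => D j k u ω) t j) i ∂P ≤ 1 := by
  induction t with
  | zero => simp [run, UserState.start, expWeight]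
  | succ t ih =>
    set S := fun ω => run ξ ord (fun i k => W i k ω) (fun j k u => D j k u ω) t with hS
    set c := fun ω => channels ξ ord (fun i k => W i k ω) (fun j k u => D j k u ω) t with hc
    let a : Ω → ENNReal := fun ω => if c ω j = i then 0 else expWeight l (μ i) (S ω j) i
    let b : Ω → ENNReal := fun ω => if c ω j = i then expWeight l (μ i) (S ω j) i else 0
    let ψ : ℕ → ENNReal := fun x => ENNReal.ofReal (Real.exp (l * (x - μ i) - l ^ 2 / 8))
    have hab : ∀ ω, a ω + b ω = expWeight l (μ i) (S ω j) i := by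
      intro ω
      by_cases h : c ω j = i <;> simp [a, b, h]
    have hY : Measurable[info W D (pastDraws U C t)] fun ω => (S ω, c ω) :=
      ((measurable_run ξ ord t).mono (info_mono (past_subset_pastDraws t)) le_rfl).prodMk
        (measurable_channels ξ ord t)
    have ha : Measurable a := by
      refine Measurable.mono ?_ (info_le hW hD (pastDraws U C t)) le_rfl
      exact (Measurable.of_discrete (f := fun y : (Fin U → UserState C) × (Fin U → Fin C) =>
        if y.2 j = i then 0 else expWeight l (μ i) (y.1 j) i)).comp hY
    have hb : Measurable[info W D (pastDraws U C t)] b :=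
      (Measurable.of_discrete (f := fun y : (Fin U → UserState C) × (Fin U → Fin C) =>
        if y.2 j = i then expWeight l (μ i) (y.1 j) i else 0)).comp hY
    have hψ : Measurable[info W D {Sum.inl (i, t + 1)}] fun ω => ψ (W i (t + 1) ω) :=
      (Measurable.of_discrete (f := ψ)).comp
        (measurable_source (x := Sum.inl (i, t + 1)) (Set.mem_singleton _))
    have hstep : ∀ ω, expWeight l (μ i)
        (run ξ ord (fun i k => W i k ω) (fun j k u => D j k u ω) (t + 1) j) i =
          a ω + b ω * ψ (W i (t + 1) ω) := by
      intro ω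
      rw [expWeight, run_succ, slot_sensed, slot_free]
      change ENNReal.ofReal (Real.exp (l * ((Function.update (S ω j).free (c ω j)
        ((S ω j).free (c ω j) + W (c ω j) (t + 1) ω) i : ℕ) -
          μ i * (Function.update (S ω j).sensed (c ω j) ((S ω j).sensed (c ω j) + 1) i : ℕ)) -
          (Function.update (S ω j).sensed (c ω j) ((S ω j).sensed (c ω j) + 1) i : ℕ) *
            (l ^ 2 / 8))) = _
      by_cases h : c ω j = i
      · subst h
        simp only [Function.update_self, a, b, if_true, zero_add, expWeight, ψ]
        rw [← ENNReal.ofReal_mul (Real.exp_nonneg _), ← Real.exp_add]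
        congr 2
        push_cast
        ring
      · simp only [Function.update_of_ne (Ne.symm h), a, b, h, if_false, zero_mul, add_zero,
          expWeight]
    have hdisj : Disjoint (pastDraws U C t) {Sum.inl (i, t + 1)} := by
      rw [Set.disjoint_singleton_right]
      rintro (h | ⟨q, hq⟩)
      · exact absurd h (Nat.not_succ_le_self t)
      · simp at hq
    simp_rw [hstep]
    rw [lintegral_add_left ha,
      lintegral_mul_eq_lintegral_mul_lintegral_of_independent_measurableSpace
        (info_le hW hD _) (info_le hW hD _) (indep_info hW hD h_indep hdisj) hb hψ]
    have hle := lintegral_exp_le_one (hW i (t + 1)) (hμ i) (h1 i (t + 1)) (h01 i (t + 1)) l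
    calc ∫⁻ ω, a ω ∂P + (∫⁻ ω, b ω ∂P) * ∫⁻ ω, ψ (W i (t + 1) ω) ∂P
        ≤ ∫⁻ ω, a ω ∂P + (∫⁻ ω, b ω ∂P) * 1 := by gcongr
      _ = ∫⁻ ω, expWeight l (μ i) (S ω j) i ∂P := by
        rw [mul_one, ← lintegral_add_left ha]
        simp_rw [hab]
      _ ≤ 1 := ih

lemma measure_not_concentrated_le (hW : ∀ i k, Measurable (W i k))
    (hD : ∀ j k u, Measurable (D j k u)) (h_indep : iIndepFun (source W D) P)
    {μ : Fin C → ℝ} (hμ : ∀ i, 0 ≤ μ i)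
    (h1 : ∀ i k, P {ω | W i k ω = 1} = ENNReal.ofReal (μ i))
    (h01 : ∀ i k, ∀ᵐ ω ∂P, W i k ω = 0 ∨ W i k ω = 1)
    (ξ : ℕ → ℝ) (ord : Fin U → Equiv.Perm (Fin C)) {t : ℕ} (ht : C ≤ t) :
    P {ω | ¬ Concentrated μ t (run ξ ord (fun i k => W i k ω) (fun j k u => D j k u ω) t)} ≤
      ENNReal.ofReal (2 * U * C / t) := by
  have ht1 : 1 ≤ t := (NeZero.one_le (n := C)).trans ht
  have ht' : (0 : ℝ) < t := by exact_mod_cast ht1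
  let a : ℕ → ℝ := fun s => 4 * Real.sqrt (2 * Real.log t / (s : ℝ))
  let B : Fin U → Fin C → ℝ → Set Ω := fun j i l => {ω | ENNReal.ofReal ((t : ℝ) ^ 4) ≤
    expWeight l (μ i) (run ξ ord (fun i k => W i k ω) (fun j k u => D j k u ω) t j) i}
  have hB : ∀ j i l, P (B j i l) ≤ ENNReal.ofReal (1 / (t : ℝ) ^ 4) := by
    intro j i l
    have hmeas : Measurable fun ω => expWeight l (μ i)
        (run ξ ord (fun i k => W i k ω) (fun j k u => D j k u ω) t j) i := by
      refine Measurable.mono ?_ (info_le hW hD (past U C t)) le_rfl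
      exact (Measurable.of_discrete (f := fun y : Fin U → UserState C =>
        expWeight l (μ i) (y j) i)).comp (measurable_run ξ ord t)
    have hpos : 0 < ENNReal.ofReal ((t : ℝ) ^ 4) := ENNReal.ofReal_pos.2 (by positivity)
    refine (meas_ge_le_lintegral_div hmeas.aemeasurable hpos.ne' ENNReal.ofReal_ne_top).trans ?_
    rw [ENNReal.ofReal_div_of_pos (by positivity), ENNReal.ofReal_one]
    gcongr
    exact lintegral_expWeight_le_one hW hD h_indep hμ h1 h01 ξ ord j i l t
  -- The exponential parameter depends on the random sensing count, so the union runs over its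
  -- possible values `1, …, t` and both signs; the factor `2 * t` is harmless against `t ^ 4`.
  have hsub : {ω | ¬ Concentrated μ t
      (run ξ ord (fun i k => W i k ω) (fun j k u => D j k u ω) t)} ⊆
      ⋃ j ∈ (Finset.univ : Finset (Fin U)), ⋃ i ∈ (Finset.univ : Finset (Fin C)),
        ⋃ s ∈ Finset.Icc 1 t, (B j i (a s) ∪ B j i (-a s)) := by
    intro ω hω
    simp only [Concentrated, Set.mem_ofPred_eq, not_forall, not_le] at hω
    obtain ⟨j, i, h⟩ := hω
    simp only [Set.mem_iUnion]
    have hT := one_le_run_sensed ξ ord (fun i k => W i k ω) (fun j k u => D j k u ω) ht j i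
    exact ⟨j, Finset.mem_univ _, i, Finset.mem_univ _, _,
      Finset.mem_Icc.2 ⟨hT, run_sensed_le ξ ord _ _ t j i⟩, le_expWeight ht1 hT h⟩
  refine (measure_mono hsub).trans ?_
  refine (measure_biUnion_finset_le _ _).trans ?_
  have hin : ∀ j i, P (⋃ s ∈ Finset.Icc 1 t, (B j i (a s) ∪ B j i (-a s))) ≤
      ENNReal.ofReal (2 / t) := by
    intro j i
    refine (measure_biUnion_finset_le _ _).trans ?_
    refine (Finset.sum_le_card_nsmul _ _ (2 * ENNReal.ofReal (1 / (t : ℝ) ^ 4))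
      fun s _ => ?_).trans ?_
    · refine (measure_union_le _ _).trans ?_
      rw [two_mul]
      exact add_le_add (hB _ _ _) (hB _ _ _)
    · rw [nsmul_eq_mul, Nat.card_Icc, Nat.add_sub_cancel, ← ENNReal.ofReal_natCast,
        ← ENNReal.ofReal_ofNat, ← ENNReal.ofReal_mul (by norm_num), ← ENNReal.ofReal_mul ht'.le]
      refine ENNReal.ofReal_le_ofReal ?_
      have h2 : (1 : ℝ) ≤ t := by exact_mod_cast ht1
      rw [mul_one_div, mul_div_assoc', div_le_div_iff₀ (by positivity) ht']
      have : (t : ℝ) ^ 2 ≤ t ^ 4 := pow_le_pow_right₀ h2 (by norm_num)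
      nlinarith
  calc ∑ j : Fin U, P (⋃ i ∈ (Finset.univ : Finset (Fin C)),
        ⋃ s ∈ Finset.Icc 1 t, (B j i (a s) ∪ B j i (-a s)))
      ≤ ∑ _j : Fin U, ∑ _i : Fin C, ENNReal.ofReal (2 / t) := by
        refine Finset.sum_le_sum fun j _ => (measure_biUnion_finset_le _ _).trans ?_
        exact Finset.sum_le_sum fun i _ => hin j i
    _ = ENNReal.ofReal (2 * U * C / t) := by
        simp only [Finset.sum_const, Finset.card_univ, Fintype.card_fin, nsmul_eq_mul]
        rw [← ENNReal.ofReal_natCast C, ← ENNReal.ofReal_mul (by positivity),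
          ← ENNReal.ofReal_natCast U, ← ENNReal.ofReal_mul (by positivity)]
        congr 1
        ring

end Concentration

/-! ### Hit probabilities and the drift in expectation -/

section Expectation

/-- Decomposing over the countably many values `y` of `Y` turns the random event `A (Y ω)` into
fixed events independent of `f`. The lower bound is needed only where `f` does not vanish. -/
lemma mul_lintegral_le_of_indep {Ω β : Type*} {m1 m2 : MeasurableSpace Ω}
    {mΩ : MeasurableSpace Ω} {P : Measure Ω} (h1 : m1 ≤ mΩ) (h2 : m2 ≤ mΩ) (h : Indep m1 m2 P)
    [Countable β] [MeasurableSpace β] [MeasurableSingletonClass β] {Y : Ω → β}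
    (hY : Measurable[m1] Y) {A : β → Set Ω} (hA : ∀ y, MeasurableSet[m2] (A y))
    {f : Ω → ENNReal} (hf : Measurable[m1] f) {p : ENNReal}
    (hp : ∀ ω, f ω ≠ 0 → p ≤ P (A (Y ω))) :
    p * ∫⁻ ω, f ω ∂P ≤ ∫⁻ ω, {ω | ω ∈ A (Y ω)}.indicator f ω ∂P := by
  have hYs : ∀ y, MeasurableSet[m1] (Y ⁻¹' {y}) := fun y => hY (measurableSet_singleton y)
  have hfy : ∀ y, Measurable[m1] ((Y ⁻¹' {y}).indicator f) := fun y => hf.indicator (hYs y)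
  have hgy : ∀ y, Measurable[m2] ((A y).indicator (1 : Ω → ENNReal)) :=
    fun y => (show Measurable[m2] (fun _ : Ω => (1 : ENNReal)) from measurable_const).indicator (hA y)
  have e1 : ∀ ω, f ω = ∑' y, (Y ⁻¹' {y}).indicator f ω := by
    intro ω
    rw [tsum_eq_single (Y ω) fun y hy => by simp [hy.symm]]
    simp
  have e2 : ∀ ω, {ω | ω ∈ A (Y ω)}.indicator f ω =
      ∑' y, (Y ⁻¹' {y}).indicator f ω * (A y).indicator 1 ω := by
    intro ω
    rw [tsum_eq_single (Y ω) fun y hy => by simp [hy.symm]]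
    by_cases hω : ω ∈ A (Y ω) <;> simp [hω]
  simp_rw [e2]
  rw [lintegral_congr e1,
    lintegral_tsum fun y => ((hfy y).mono h1 le_rfl).aemeasurable,
    lintegral_tsum (f := fun y ω => (Y ⁻¹' {y}).indicator f ω * (A y).indicator 1 ω) fun y =>
      (((hfy y).mono h1 le_rfl).mul ((hgy y).mono h2 le_rfl)).aemeasurable,
    ← ENNReal.tsum_mul_left]
  refine ENNReal.tsum_le_tsum fun y => ?_
  rw [lintegral_mul_eq_lintegral_mul_lintegral_of_independent_measurableSpace h1 h2 h (hfy y)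
    (hgy y), lintegral_indicator_one (h2 _ (hA y)), mul_comm]
  by_cases hy : ∃ ω, Y ω = y ∧ f ω ≠ 0
  · obtain ⟨ω, rfl, hω⟩ := hy
    gcongr
    exact hp ω hω
  · push Not at hy
    have : (Y ⁻¹' {y}).indicator f = 0 := by
      funext ω
      by_cases h : Y ω = y
      · simp [h, hy ω h]
      · simp [h]
    simp [this]

variable {Ω : Type*} [MeasurableSpace Ω] {P : Measure Ω}
  {W : Fin C → ℕ → Ω → ℕ} {D : Fin U → ℕ → ℕ → Ω → ℕ}

/-- For fixed `u` the events concern distinct members of the independent family, and each draw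
contributes `1 / u j ≥ 1 / U`. -/
lemma measure_free_and_draws_ge (h_indep : iIndepFun (source W D) P) {μ : Fin C → ℝ}
    (h1 : ∀ i k, P {ω | W i k ω = 1} = ENNReal.ofReal (μ i))
    (hunif : ∀ j k u, ∀ r ∈ Finset.Icc 1 u, P {ω | D j k u ω = r} = (u : ENNReal)⁻¹)
    (s : ℕ) {u r : Fin U → ℕ} (hu : ∀ j, u j ≤ U) (hr : ∀ j, r j ∈ Finset.Icc 1 (u j)) :
    (∏ i, ENNReal.ofReal (μ i)) * (U : ENNReal)⁻¹ ^ U ≤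
      P {ω | (∀ i, W i s ω = 1) ∧ ∀ j, D j s (u j) ω = r j} := by
  let e : Fin C ⊕ Fin U → Index U C := Sum.map (fun i => (i, s)) fun j => (j, s, u j)
  have he : Function.Injective e := by
    refine Function.Injective.sumMap (fun a b h => ?_) fun a b h => ?_
    · exact (Prod.mk.inj h).1
    · exact (Prod.mk.inj h).1
  have h := h_indep.precomp he
  rw [iIndepFun_iff_measure_inter_preimage_eq_mul] at h
  have h2 := h Finset.univ (sets := Sum.elim (fun _ => {1}) fun j => {r j})
    fun _ _ => MeasurableSet.of_discrete
  have hset : (⋂ x ∈ (Finset.univ : Finset (Fin C ⊕ Fin U)),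
      source W D (e x) ⁻¹' (Sum.elim (fun _ => {1}) (fun j => {r j}) x : Set ℕ)) =
      {ω | (∀ i, W i s ω = 1) ∧ ∀ j, D j s (u j) ω = r j} := by
    ext ω
    simp [e, source]
  rw [hset, Fintype.prod_sum_type] at h2
  rw [h2]
  refine mul_le_mul' (le_of_eq (Finset.prod_congr rfl fun i _ => (h1 i s).symm)) ?_
  calc (U : ENNReal)⁻¹ ^ U = ∏ _j : Fin U, (U : ENNReal)⁻¹ := by simp
    _ ≤ ∏ j : Fin U, (u j : ENNReal)⁻¹ := by
      refine Finset.prod_le_prod' fun j _ => ?_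
      gcongr
      exact hu j
    _ = _ := Finset.prod_congr rfl fun j _ => (hunif j s (u j) (r j) (hr j)).symm

lemma ae_draw_mem [IsProbabilityMeasure P] (hD : ∀ j k u, Measurable (D j k u))
    (hunif : ∀ j k u, ∀ r ∈ Finset.Icc 1 u, P {ω | D j k u ω = r} = (u : ENNReal)⁻¹) :
    ∀ᵐ ω ∂P, ∀ j k u, 1 ≤ u → D j k u ω ∈ Finset.Icc 1 u := by
  simp only [ae_all_iff]
  intro j k u hu
  have hm : ∀ r, MeasurableSet {ω | D j k u ω = r} := fun r => hD j k u (measurableSet_singleton r)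
  have hset : {ω | D j k u ω ∈ Finset.Icc 1 u} = ⋃ r ∈ Finset.Icc 1 u, {ω | D j k u ω = r} := by
    ext ω; simp
  have hone : P {ω | D j k u ω ∈ Finset.Icc 1 u} = 1 := by
    rw [hset, measure_biUnion_finset (fun r _ r' _ hne => ?_) fun r _ => hm r,
      Finset.sum_congr rfl (hunif j k u)]
    · simp only [Finset.sum_const, Nat.card_Icc, Nat.add_sub_cancel, nsmul_eq_mul]
      exact ENNReal.mul_inv_cancel (by exact_mod_cast (by omega : u ≠ 0))
        (ENNReal.natCast_ne_top u)
    · rw [Function.onFun, Set.disjoint_left]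
      intro ω h h'
      exact hne (h.symm.trans h')
  exact (mem_ae_iff_prob_eq_one (hD j k u MeasurableSet.of_discrete)).2 hone

lemma ae_availability [IsProbabilityMeasure P] (hW : ∀ i k, Measurable (W i k)) {μ : Fin C → ℝ}
    (hμ : ∀ i, μ i ∈ Set.Ioo (0 : ℝ) 1)
    (h1 : ∀ i k, P {ω | W i k ω = 1} = ENNReal.ofReal (μ i))
    (h0 : ∀ i k, P {ω | W i k ω = 0} = ENNReal.ofReal (1 - μ i)) (i : Fin C) (k : ℕ) :
    ∀ᵐ ω ∂P, W i k ω = 0 ∨ W i k ω = 1 := by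
  have hm : ∀ r, MeasurableSet {ω | W i k ω = r} := fun r => hW i k (measurableSet_singleton r)
  have hset : {ω | W i k ω = 0 ∨ W i k ω = 1} = {ω | W i k ω = 0} ∪ {ω | W i k ω = 1} := rfl
  have hdisj : Disjoint {ω | W i k ω = 0} {ω | W i k ω = 1} := by
    rw [Set.disjoint_left]
    intro ω h h'
    simp only [Set.mem_ofPred_eq] at h h'
    omega
  have hone : P {ω | W i k ω = 0 ∨ W i k ω = 1} = 1 := by
    rw [hset, measure_union hdisj (hm 1), h0, h1,
      ← ENNReal.ofReal_add (by linarith [(hμ i).2]) (hμ i).1.le]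
    simp
  exact (mem_ae_iff_prob_eq_one ((hm 0).union (hm 1))).2 hone

variable [NeZero C] {ξ : ℕ → ℝ} {ord : Fin U → Equiv.Perm (Fin C)} {μ : Fin C → ℝ} {Δ : ℝ}
  {n M Q t : ℕ}

open Classical in
-- The aims are determined by the end of slot `t + 1`, while the availabilities and draws tested by
-- a hit belong to slot `t + 2`. Activity keeps the estimates at most `U`, as the probability bound
-- requires.
lemma mul_lintegral_gain_le (hW : ∀ i k, Measurable (W i k)) (hD : ∀ j k u, Measurable (D j k u))
    (h_indep : iIndepFun (source W D) P)
    (h1 : ∀ i k, P {ω | W i k ω = 1} = ENNReal.ofReal (μ i))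
    (hunif : ∀ j k u, ∀ r ∈ Finset.Icc 1 u, P {ω | D j k u ω = r} = (u : ENNReal)⁻¹)
    (f : Ω → ENNReal) (hf : Measurable[info W D (past U C (t + 1))] f)
    (hfa : ∀ ω, f ω ≠ 0 →
      Active ξ ord (fun i k => W i k ω) (fun j k u => D j k u ω) μ Δ n t) :
    ((∏ i, ENNReal.ofReal (μ i)) * (U : ENNReal)⁻¹ ^ U) * ∫⁻ ω, f ω ∂P ≤
      ∫⁻ ω, (if Hit ξ ord (fun i k => W i k ω) (fun j k u => D j k u ω) μ Δ n t then f ω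
        else 0) ∂P := by
  have hdisj : Disjoint (past U C (t + 1)) {x : Index U C | x.time = t + 1 + 1} := by
    rw [Set.disjoint_left]
    intro x hx hx'
    have hx1 : x.time ≤ t + 1 := hx
    have hx2 : x.time = t + 1 + 1 := hx'
    omega
  let A : (Fin U → ℕ) × (Fin U → ℕ) → Set Ω := fun y =>
    {ω | (∀ i, W i (t + 1 + 1) ω = 1) ∧ ∀ j, D j (t + 1 + 1) (y.1 j) ω = y.2 j}
  have hA : ∀ y, MeasurableSet[info W D {x : Index U C | x.time = t + 1 + 1}] (A y) := by
    intro y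
    have : A y = (⋂ i, W i (t + 1 + 1) ⁻¹' {1}) ∩
        ⋂ j, D j (t + 1 + 1) (y.1 j) ⁻¹' {y.2 j} := by
      ext ω; simp [A]
    rw [this]
    refine MeasurableSet.inter (MeasurableSet.iInter fun i => ?_)
      (MeasurableSet.iInter fun j => ?_)
    · exact measurable_source (W := W) (D := D)
        (I := {x : Index U C | x.time = t + 1 + 1}) (x := Sum.inl (i, t + 1 + 1)) rfl
        (measurableSet_singleton 1)
    · exact measurable_source (W := W) (D := D)
        (I := {x : Index U C | x.time = t + 1 + 1}) (x := Sum.inr (j, t + 1 + 1, y.1 j)) rfl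
        (measurableSet_singleton (y.2 j))
  refine (mul_lintegral_le_of_indep (info_le hW hD _) (info_le hW hD _)
    (indep_info hW hD h_indep hdisj) (measurable_aim ξ ord μ Δ n t) hA hf fun ω hω => ?_).trans_eq
    (lintegral_congr fun ω => ?_)
  · have hact := hfa ω hω
    refine measure_free_and_draws_ge h_indep h1 hunif _ (fun j => ?_) fun j => ?_
    · by_contra! h
      refine hact.1 ⟨j, ?_⟩
      rwa [← estimate_eq_of_not_disrupted hact.2.1]
    · exact targetRank_mem _ (one_le_run_estimate ..) _
  · rw [Set.indicator_apply]
    exact if_congr Iff.rfl rfl rfl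

open Classical in
-- By `hQp` the hit term of `energy_drift` integrates to at least the expected gain plus the
-- probability of activity. The gain has finite expectation and cancels.
lemma lintegral_drift [IsProbabilityMeasure P] (hΔ : 0 < Δ) (hgap : ∀ x y, x ≠ y → Δ ≤ |μ x - μ y|) (hUC : U ≤ C)
    (hW : ∀ i k, Measurable (W i k)) (hD : ∀ j k u, Measurable (D j k u))
    (h_indep : iIndepFun (source W D) P)
    (h1 : ∀ i k, P {ω | W i k ω = 1} = ENNReal.ofReal (μ i))
    (hunif : ∀ j k u, ∀ r ∈ Finset.Icc 1 u, P {ω | D j k u ω = r} = (u : ENNReal)⁻¹)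
    (hQ : 1 ≤ Q) (hQp : 1 ≤ (∏ i, ENNReal.ofReal (μ i)) * (U : ENNReal)⁻¹ ^ U * Q)
    (hM : ∀ x : Config U C, x.Valid (position μ) → Near (position μ) M x)
    (ht : C ≤ t) (htn : t < n) :
    ∫⁻ ω, (energy ξ ord (fun i k => W i k ω) (fun j k u => D j k u ω) μ Δ n M Q (t + 1) : ℕ) ∂P +
      ∫⁻ ω, (if Unsettled ξ ord (fun i k => W i k ω) (fun j k u => D j k u ω) μ Δ n t
        then 1 else 0 : ℕ) ∂P ≤
    ∫⁻ ω, (energy ξ ord (fun i k => W i k ω) (fun j k u => D j k u ω) μ Δ n M Q t : ℕ) ∂P +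
      (weight Q M + 1 : ℕ) * ∫⁻ ω, (if Broken ξ ord (fun i k => W i k ω) (fun j k u => D j k u ω)
        μ Δ n (t + 1) then 1 else 0 : ℕ) ∂P := by
  let w : Ω → Fin C → ℕ → ℕ := fun ω i k => W i k ω
  let d : Ω → Fin U → ℕ → ℕ → ℕ := fun ω j k u => D j k u ω
  let e : ℕ → Ω → ENNReal := fun s ω => (energy ξ ord (w ω) (d ω) μ Δ n M Q s : ℕ)
  let g : Ω → ENNReal := fun ω => (gain ξ ord (w ω) (d ω) μ Δ n M Q t : ℕ)
  let a : Ω → ENNReal := fun ω =>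
    (if Active ξ ord (w ω) (d ω) μ Δ n t then 1 else 0 : ℕ)
  let b : ℕ → Ω → ENNReal := fun s ω =>
    (if Broken ξ ord (w ω) (d ω) μ Δ n s then 1 else 0 : ℕ)
  let h : Ω → ENNReal := fun ω => if Hit ξ ord (w ω) (d ω) μ Δ n t then Q * (g ω + a ω) else 0
  have hcast : Measurable (fun k : ℕ => (k : ENNReal)) := Measurable.of_discrete
  have hle : ∀ s, info W D (past U C s) ≤ ‹MeasurableSpace Ω› := fun s => info_le hW hD _
  have hem : ∀ s, Measurable (e s) := fun s =>
    hcast.comp ((measurable_energy ξ ord μ Δ n M Q s).mono (hle _) le_rfl)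
  have hgm : Measurable[info W D (past U C (t + 1))] g :=
    hcast.comp (measurable_gain ξ ord μ Δ n M Q t)
  have ham : Measurable[info W D (past U C (t + 1))] a :=
    hcast.comp (Measurable.ite (measurableSet_active ξ ord μ Δ n t) measurable_const
      measurable_const)
  have hbm : ∀ s, Measurable (b s) := fun s =>
    hcast.comp (Measurable.ite (hle _ _ (measurableSet_broken ξ ord μ Δ n s)) measurable_const
      measurable_const)
  have hgm' : Measurable g := hgm.mono (hle _) le_rfl
  have ham' : Measurable a := ham.mono (hle _) le_rfl
  have hdrift : ∫⁻ ω, (e (t + 1) ω + b t ω + h ω) ∂P ≤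
      ∫⁻ ω, (e t ω + g ω + (weight Q M + 1 : ℕ) * b (t + 1) ω) ∂P := by
    refine lintegral_mono_ae ?_
    filter_upwards [ae_draw_mem hD hunif] with ω hω
    have := energy_drift (ξ := ξ) (ord := ord) (w := w ω) (d := d ω) hΔ hgap hUC hω ht htn hQ hM
    rw [add_right_comm] at this
    simp only [e, b, h, g, a]
    split_ifs at this ⊢ <;> exact_mod_cast this
  have hhit : ∫⁻ ω, g ω ∂P + ∫⁻ ω, a ω ∂P ≤ ∫⁻ ω, h ω ∂P := by
    have h2 := mul_lintegral_gain_le (ξ := ξ) (ord := ord) (Δ := Δ) (n := n) hW hD h_indep h1 hunif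
      (fun ω => Q * (g ω + a ω)) ((hgm.add ham).const_mul _) (fun ω hω => by
        by_contra hna
        refine hω ?_
        simp only [g, a, gain]
        rw [if_neg hna, if_neg hna]
        simp)
    refine le_trans ?_ h2
    have hga : Measurable fun ω => g ω + a ω := hgm'.add ham'
    rw [lintegral_const_mul _ hga, ← mul_assoc, lintegral_add_left hgm']
    exact le_mul_of_one_le_left zero_le hQp
  have hgfin : ∫⁻ ω, g ω ∂P ≠ ⊤ := by
    refine ne_top_of_le_ne_top (ENNReal.natCast_ne_top (weight Q M)) ?_
    calc ∫⁻ ω, g ω ∂P ≤ ∫⁻ _, (weight Q M : ℕ) ∂P := by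
          refine lintegral_mono fun ω => ?_
          have : gain ξ ord (w ω) (d ω) μ Δ n M Q t ≤ weight Q M := by
            unfold gain
            split_ifs
            · exact weight_mono hQ (Nat.sub_le _ _)
            · exact Nat.zero_le _
          change ((gain ξ ord (w ω) (d ω) μ Δ n M Q t : ℕ) : ENNReal) ≤ _
          exact_mod_cast this
      _ = _ := by simp
  have heb : Measurable fun ω => e (t + 1) ω + b t ω := (hem _).add (hbm _)
  have heg : Measurable fun ω => e t ω + g ω := (hem _).add hgm'
  rw [lintegral_add_left heb, lintegral_add_left (hem _), lintegral_add_left heg, lintegral_add_left (hem _),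
    lintegral_const_mul _ (hbm _)] at hdrift
  have huns : ∫⁻ ω, (if Unsettled ξ ord (w ω) (d ω) μ Δ n t then 1 else 0 : ℕ) ∂P =
      ∫⁻ ω, a ω ∂P + ∫⁻ ω, b t ω ∂P := by
    rw [← lintegral_add_left ham']
    refine lintegral_congr fun ω => ?_
    rw [unsettled_indicator]
    push_cast
    simp only [a, b]
    push_cast
    rfl
  change ∫⁻ ω, e (t + 1) ω ∂P +
    ∫⁻ ω, (if Unsettled ξ ord (w ω) (d ω) μ Δ n t then 1 else 0 : ℕ) ∂P ≤
    ∫⁻ ω, e t ω ∂P + (weight Q M + 1 : ℕ) * ∫⁻ ω, b (t + 1) ω ∂P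
  rw [huns]
  refine (ENNReal.add_le_add_iff_right hgfin).1 ?_
  calc ∫⁻ ω, e (t + 1) ω ∂P + (∫⁻ ω, a ω ∂P + ∫⁻ ω, b t ω ∂P) + ∫⁻ ω, g ω ∂P
      = ∫⁻ ω, e (t + 1) ω ∂P + ∫⁻ ω, b t ω ∂P + (∫⁻ ω, g ω ∂P + ∫⁻ ω, a ω ∂P) := by ring
    _ ≤ ∫⁻ ω, e (t + 1) ω ∂P + ∫⁻ ω, b t ω ∂P + ∫⁻ ω, h ω ∂P := by gcongr
    _ ≤ _ := hdrift
    _ = _ := by ring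

end Expectation

/-! ### Logarithmic bounds and Markov's inequality -/

section Final

lemma exists_gap {μ : Fin C → ℝ} (hμ : Function.Injective μ) :
    ∃ Δ > 0, ∀ x y, x ≠ y → Δ ≤ |μ x - μ y| := by
  classical
  rcases (Finset.univ : Finset (Fin C)).offDiag.eq_empty_or_nonempty with h | h
  · refine ⟨1, one_pos, fun x y hxy => ?_⟩
    have : (x, y) ∈ (Finset.univ : Finset (Fin C)).offDiag := by simp [hxy]
    simp [h] at this
  · obtain ⟨p, hp, hmin⟩ := Finset.exists_min_image _ (fun p => |μ p.1 - μ p.2|) h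
    refine ⟨|μ p.1 - μ p.2|, ?_, fun x y hxy => hmin (x, y) (by simp [hxy])⟩
    have : p.1 ≠ p.2 := by simpa using hp
    exact abs_pos.2 (sub_ne_zero.2 fun h => this (hμ h))

lemma sum_inv_le (hC : 1 ≤ C) (n : ℕ) :
    ∑ t ∈ Finset.Ico C (n + 1), (1 : ℝ) / t ≤ 1 + Real.log n := by
  refine le_trans ?_ (harmonic_le_one_add_log n)
  rw [harmonic_eq_sum_Icc]
  push_cast
  simp only [one_div]
  refine Finset.sum_le_sum_of_subset_of_nonneg (fun t ht => ?_) fun t _ _ => by positivity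
  rw [Finset.mem_Ico] at ht
  rw [Finset.mem_Icc]
  omega

variable {Ω : Type*} [MeasurableSpace Ω] {P : Measure Ω} [IsProbabilityMeasure P]
  {W : Fin C → ℕ → Ω → ℕ} {D : Fin U → ℕ → ℕ → Ω → ℕ} [NeZero C]
  {ord : Fin U → Equiv.Perm (Fin C)} {μ : Fin C → ℝ} {Δ : ℝ}

open Classical in
/-- The expected number of disrupted slots is logarithmic in the horizon. -/
lemma exists_lintegral_broken_le (hΔ : 0 < Δ) (hW : ∀ i k, Measurable (W i k))
    (hD : ∀ j k u, Measurable (D j k u)) (h_indep : iIndepFun (source W D) P)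
    (hμ : ∀ i, 0 ≤ μ i) (h1 : ∀ i k, P {ω | W i k ω = 1} = ENNReal.ofReal (μ i))
    (h01 : ∀ i k, ∀ᵐ ω ∂P, W i k ω = 0 ∨ W i k ω = 1) :
    ∃ a b : ℝ, 0 ≤ a ∧ 0 ≤ b ∧ ∀ (ξ : ℕ → ℝ) (n : ℕ), ∑ t ∈ Finset.Ico C (n + 1),
      ∫⁻ ω, (if Broken ξ ord (fun i k => W i k ω) (fun j k u => D j k u ω) μ Δ n t
        then 1 else 0 : ℕ) ∂P ≤ ENNReal.ofReal (a * Real.log n + b) := by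
  have hΔ2 : 0 < Δ ^ 2 := by positivity
  set K := ⌊8 / Δ ^ 2⌋₊ + 1 with hKdef
  have hK : ∀ t : ℕ, Δ ^ 2 * t ≤ 8 → t < K := by
    intro t ht
    refine Nat.lt_succ_of_le (Nat.le_floor ?_)
    rw [le_div_iff₀ hΔ2]
    linarith
  -- The term `U * C * ℓ` with `ℓ ≤ 32 * log n / Δ ^ 2 + 1` and the harmonic sum of the
  -- probabilities `2 * U * C / t` give the logarithms. The constants must not involve `ξ`, since
  -- the thresholds vary with the horizon.
  refine ⟨U * C * (32 / Δ ^ 2) + 2 * U * C, K + U * (C + (U + 1)) + 2 * U * C, by positivity,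
    by positivity, fun ξ n => ?_⟩
  have hlog : 0 ≤ Real.log n := Real.log_natCast_nonneg n
  set ℓ := ⌊32 * Real.log n / Δ ^ 2⌋₊ + 1 with hℓdef
  have hℓ : ∀ T : ℕ, Δ ^ 2 * T ≤ 32 * Real.log n → T < ℓ := by
    intro T hT
    refine Nat.lt_succ_of_le (Nat.le_floor ?_)
    rw [le_div_iff₀ hΔ2]
    linarith
  have hℓle : (ℓ : ℝ) ≤ 32 * Real.log n / Δ ^ 2 + 1 := by
    rw [hℓdef]
    push_cast
    gcongr
    exact Nat.floor_le (by positivity)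
  have hle : ∀ s, info W D (past U C s) ≤ ‹MeasurableSpace Ω› := fun s => info_le hW hD _
  have hcast : Measurable (fun k : ℕ => (k : ENNReal)) := Measurable.of_discrete
  have hbm : ∀ t, Measurable fun ω =>
      ((if Broken ξ ord (fun i k => W i k ω) (fun j k u => D j k u ω) μ Δ n t
        then 1 else 0 : ℕ) : ENNReal) := fun t =>
    hcast.comp (Measurable.ite (hle _ _ (measurableSet_broken ξ ord μ Δ n t)) measurable_const
      measurable_const)
  have hcm : ∀ t, MeasurableSet {ω | ¬ Concentrated μ t
      (run ξ ord (fun i k => W i k ω) (fun j k u => D j k u ω) t)} := fun t =>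
    (measurable_run ξ ord t).mono (hle t) le_rfl
      (MeasurableSet.of_discrete (s := {S | ¬ Concentrated μ t S}))
  rw [← lintegral_finsetSum _ fun t _ => hbm t]
  calc ∫⁻ ω, ∑ t ∈ Finset.Ico C (n + 1),
        ((if Broken ξ ord (fun i k => W i k ω) (fun j k u => D j k u ω) μ Δ n t
          then 1 else 0 : ℕ) : ENNReal) ∂P
      ≤ ∫⁻ ω, (((K + U * (C * ℓ + (U + 1)) : ℕ) : ENNReal) + ∑ t ∈ Finset.Ico C (n + 1),
          {ω | ¬ Concentrated μ t (run ξ ord (fun i k => W i k ω)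
            (fun j k u => D j k u ω) t)}.indicator 1 ω) ∂P := by
        refine lintegral_mono fun ω => ?_
        have := sum_broken_le (ξ := ξ) (ord := ord) (w := fun i k => W i k ω)
          (d := fun j k u => D j k u ω) (μ := μ) hℓ hK (n + 1)
        have h2 : ((∑ t ∈ Finset.Ico C (n + 1), if Broken ξ ord (fun i k => W i k ω)
            (fun j k u => D j k u ω) μ Δ n t then 1 else 0 : ℕ) : ENNReal) ≤ _ :=
          Nat.cast_le.2 this
        rw [Nat.cast_add, Nat.cast_sum, Nat.cast_sum] at h2
        refine h2.trans (add_le_add le_rfl (Finset.sum_le_sum fun t _ => ?_))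
        rw [Set.indicator_apply]
        simp only [Set.mem_ofPred_eq, Pi.one_apply]
        split_ifs <;> simp
    _ = ((K + U * (C * ℓ + (U + 1)) : ℕ) : ENNReal) + ∑ t ∈ Finset.Ico C (n + 1),
          P {ω | ¬ Concentrated μ t (run ξ ord (fun i k => W i k ω)
            (fun j k u => D j k u ω) t)} := by
        rw [lintegral_add_left measurable_const,
          lintegral_finsetSum _ fun t _ => measurable_one.indicator (hcm t)]
        simp only [lintegral_const, measure_univ, mul_one]
        congr 1
        exact Finset.sum_congr rfl fun t _ => lintegral_indicator_one (hcm t)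
    _ ≤ ENNReal.ofReal (K + U * (C * ℓ + (U + 1)) : ℕ) + ∑ t ∈ Finset.Ico C (n + 1),
          ENNReal.ofReal (2 * U * C / t) := by
        rw [ENNReal.ofReal_natCast]
        gcongr with t ht
        exact measure_not_concentrated_le hW hD h_indep hμ h1 h01 ξ ord (Finset.mem_Ico.1 ht).1
    _ = ENNReal.ofReal ((K + U * (C * ℓ + (U + 1)) : ℕ) +
          2 * U * C * ∑ t ∈ Finset.Ico C (n + 1), (1 : ℝ) / t) := by
        rw [← ENNReal.ofReal_sum_of_nonneg fun t _ => by positivity,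
          ← ENNReal.ofReal_add (by positivity) (Finset.sum_nonneg fun t _ => by positivity),
          Finset.mul_sum]
        simp only [mul_one_div]
    _ ≤ _ := by
        refine ENNReal.ofReal_le_ofReal ?_
        have hs := sum_inv_le (C := C) NeZero.one_le n
        have h3 : 2 * (U : ℝ) * C * ∑ t ∈ Finset.Ico C (n + 1), (1 : ℝ) / t ≤
            2 * U * C * (1 + Real.log n) := by gcongr
        have h4 : ((K + U * (C * ℓ + (U + 1)) : ℕ) : ℝ) ≤
            K + U * (C * (32 * Real.log n / Δ ^ 2 + 1) + (U + 1)) := by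
          push_cast
          gcongr
        calc _ ≤ _ := add_le_add h4 h3
          _ = _ := by ring

open Classical in
/-- The expected number of unsettled slots is logarithmic in the horizon. -/
lemma exists_lintegral_unsettled_le (hΔ : 0 < Δ) (hgap : ∀ x y, x ≠ y → Δ ≤ |μ x - μ y|)
    (hU : 1 ≤ U) (hUC : U ≤ C) (hW : ∀ i k, Measurable (W i k))
    (hD : ∀ j k u, Measurable (D j k u)) (h_indep : iIndepFun (source W D) P)
    (hμ : ∀ i, 0 < μ i) (h1 : ∀ i k, P {ω | W i k ω = 1} = ENNReal.ofReal (μ i))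
    (h01 : ∀ i k, ∀ᵐ ω ∂P, W i k ω = 0 ∨ W i k ω = 1)
    (hunif : ∀ j k u, ∀ r ∈ Finset.Icc 1 u, P {ω | D j k u ω = r} = (u : ENNReal)⁻¹) :
    ∃ a b : ℝ, 0 ≤ a ∧ 0 ≤ b ∧ ∀ (ξ : ℕ → ℝ) (n : ℕ),
      ∫⁻ ω, (∑ t ∈ Finset.Ico C n, if Unsettled ξ ord (fun i k => W i k ω)
        (fun j k u => D j k u ω) μ Δ n t then 1 else 0 : ℕ) ∂P ≤
          ENNReal.ofReal (a * Real.log n + b) := by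
  obtain ⟨M, hM⟩ := exists_forall_near (position μ) hUC hU
  set p : ENNReal := (∏ i, ENNReal.ofReal (μ i)) * (U : ENNReal)⁻¹ ^ U with hp
  have hp0 : p ≠ 0 := by
    refine mul_ne_zero (Finset.prod_ne_zero_iff.2 fun i _ => ?_) (pow_ne_zero _ ?_)
    · exact (ENNReal.ofReal_pos.2 (hμ i)).ne'
    · exact ENNReal.inv_ne_zero.2 (ENNReal.natCast_ne_top U)
  obtain ⟨Q, hQp⟩ := ENNReal.exists_nat_mul_gt hp0 ENNReal.one_ne_top
  have hQ : 1 ≤ Q := by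
    by_contra! h
    have : Q = 0 := by omega
    simp [this] at hQp
  rw [mul_comm] at hQp
  obtain ⟨a, b, ha, hb, hab⟩ := exists_lintegral_broken_le (ord := ord) hΔ hW hD h_indep
    (fun i => (hμ i).le) h1 h01
  set V : ℕ := weight Q M + 1 with hV
  refine ⟨V * a, V + V * b, by positivity, by positivity, fun ξ n => ?_⟩
  let w : Ω → Fin C → ℕ → ℕ := fun ω i k => W i k ω
  let d : Ω → Fin U → ℕ → ℕ → ℕ := fun ω j k u => D j k u ω
  let e : ℕ → ENNReal := fun s => ∫⁻ ω, (energy ξ ord (w ω) (d ω) μ Δ n M Q s : ℕ) ∂P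
  let x : ℕ → ENNReal := fun s =>
    ∫⁻ ω, (if Unsettled ξ ord (w ω) (d ω) μ Δ n s then 1 else 0 : ℕ) ∂P
  let y : ℕ → ENNReal := fun s =>
    ∫⁻ ω, (if Broken ξ ord (w ω) (d ω) μ Δ n s then 1 else 0 : ℕ) ∂P
  have hdrift : ∀ t, C ≤ t → t < n → e (t + 1) + x t ≤ e t + V * y (t + 1) := fun t ht htn =>
    lintegral_drift hΔ hgap hUC hW hD h_indep h1 hunif hQ hQp.le hM ht htn
  have hsum : ∀ m, C ≤ m → m ≤ n →
      e m + ∑ t ∈ Finset.Ico C m, x t ≤ e C + V * ∑ t ∈ Finset.Ico C m, y (t + 1) := by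
    intro m hm
    induction m, hm using Nat.le_induction with
    | base => simp
    | succ m hm ih =>
      intro hmn
      rw [Finset.sum_Ico_succ_top hm, Finset.sum_Ico_succ_top hm]
      calc e (m + 1) + (∑ t ∈ Finset.Ico C m, x t + x m)
          = (e (m + 1) + x m) + ∑ t ∈ Finset.Ico C m, x t := by ring
        _ ≤ (e m + V * y (m + 1)) + ∑ t ∈ Finset.Ico C m, x t :=
          add_le_add (hdrift m hm hmn) le_rfl
        _ = (e m + ∑ t ∈ Finset.Ico C m, x t) + V * y (m + 1) := by ring
        _ ≤ (e C + V * ∑ t ∈ Finset.Ico C m, y (t + 1)) + V * y (m + 1) :=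
          add_le_add (ih (by omega)) le_rfl
        _ = _ := by ring
  have hxm : ∀ t, Measurable fun ω =>
      ((if Unsettled ξ ord (w ω) (d ω) μ Δ n t then 1 else 0 : ℕ) : ENNReal) := by
    intro t
    have hle : info W D (past U C (t + 1)) ≤ ‹MeasurableSpace Ω› := info_le hW hD _
    have hcast : Measurable (fun k : ℕ => (k : ENNReal)) := Measurable.of_discrete
    simp_rw [unsettled_indicator]
    exact hcast.comp (((Measurable.ite (measurableSet_active ξ ord μ Δ n t) measurable_const
      measurable_const).mono hle le_rfl).add ((Measurable.ite
        (measurableSet_broken ξ ord μ Δ n t) measurable_const measurable_const).mono hle le_rfl))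
  by_cases hCn : C ≤ n
  · simp only [Nat.cast_sum]
    rw [lintegral_finsetSum _ fun t _ => hxm t]
    have heC : e C ≤ V := by
      calc e C ≤ ∫⁻ _, (V : ENNReal) ∂P := lintegral_mono fun ω => Nat.cast_le.2 energy_le
        _ = V := by simp
    -- The drift charges a disruption to the preceding slot, hence the range up to `n + 1` in the
    -- bound on disrupted slots.
    have hy : ∑ t ∈ Finset.Ico C n, y (t + 1) ≤ ENNReal.ofReal (a * Real.log n + b) := by
      refine le_trans ?_ (hab ξ n)
      rw [Finset.sum_Ico_add' y C n 1]
      exact Finset.sum_le_sum_of_subset (Finset.Ico_subset_Ico_left (Nat.le_succ C))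
    calc ∑ t ∈ Finset.Ico C n, x t ≤ e n + ∑ t ∈ Finset.Ico C n, x t := le_add_self
      _ ≤ e C + V * ∑ t ∈ Finset.Ico C n, y (t + 1) := hsum n hCn le_rfl
      _ ≤ V + V * ENNReal.ofReal (a * Real.log n + b) := by gcongr
      _ = ENNReal.ofReal (V * a * Real.log n + (V + V * b)) := by
        have hlog : 0 ≤ Real.log n := Real.log_natCast_nonneg n
        rw [← ENNReal.ofReal_natCast V, ← ENNReal.ofReal_mul (by positivity),
          ← ENNReal.ofReal_add (by positivity) (by positivity)]
        congr 1
        ring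
  · rw [Finset.Ico_eq_empty (by omega)]
    simp

lemma measurableSet_over (hW : ∀ i k, Measurable (W i k)) (hD : ∀ j k u, Measurable (D j k u))
    (ξ : ℕ → ℝ) (n : ℕ) :
    MeasurableSet {ω | Over (run ξ ord (fun i k => W i k ω) (fun j k u => D j k u ω) n)} :=
  (measurable_run ξ ord n).mono (info_le hW hD _) le_rfl
    (MeasurableSet.of_discrete (s := {S | Over S}))

/-- By `threshold_lt_of_over`, over-estimation forces more than `ξ n U` unsettled slots; Markov's
inequality bounds its probability by `(a * log n + b) / ξ n U`. -/
lemma tendsto_measure_over (hU : 2 ≤ U) (hUC : U ≤ C) (hμ : ∀ i, 0 < μ i)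
    (hμ_inj : Function.Injective μ) (hW : ∀ i k, Measurable (W i k))
    (hD : ∀ j k u, Measurable (D j k u)) (h_indep : iIndepFun (source W D) P)
    (h1 : ∀ i k, P {ω | W i k ω = 1} = ENNReal.ofReal (μ i))
    (h01 : ∀ i k, ∀ᵐ ω ∂P, W i k ω = 0 ∨ W i k ω = 1)
    (hunif : ∀ j k u, ∀ r ∈ Finset.Icc 1 u, P {ω | D j k u ω = r} = (u : ENNReal)⁻¹)
    {ξ : ℕ → ℕ → ℝ} (hξ : Tendsto (fun n : ℕ => ξ n U / Real.log n) atTop atTop) :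
    Tendsto (fun n : ℕ => P {ω | Over (run (ξ n) ord (fun i k => W i k ω)
      (fun j k u => D j k u ω) n)}) atTop (𝓝 0) := by
  classical
  obtain ⟨Δ, hΔ, hgap⟩ := exists_gap hμ_inj
  obtain ⟨a, b, ha, hb, hab⟩ := exists_lintegral_unsettled_le (ord := ord) hΔ hgap (by omega) hUC
    hW hD h_indep hμ h1 h01 hunif
  have hlog : Tendsto (fun n : ℕ => Real.log n) atTop atTop :=
    Real.tendsto_log_atTop.comp tendsto_natCast_atTop_atTop
  have hlim : Tendsto (fun n : ℕ => (a * Real.log n + b) / ξ n U) atTop (𝓝 0) := by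
    have h2 : Tendsto (fun n : ℕ => (a + b / Real.log n) * (ξ n U / Real.log n)⁻¹) atTop
        (𝓝 ((a + 0) * 0)) :=
      (tendsto_const_nhds.add (tendsto_const_nhds.div_atTop hlog)).mul hξ.inv_tendsto_atTop
    rw [mul_zero] at h2
    refine h2.congr' ?_
    filter_upwards [hlog.eventually_gt_atTop 0] with n hn
    rw [inv_div, div_eq_mul_inv _ (ξ n U)]
    field_simp
  have hlim' := ENNReal.tendsto_ofReal hlim
  rw [ENNReal.ofReal_zero] at hlim'
  refine tendsto_of_tendsto_of_tendsto_of_le_of_le' tendsto_const_nhds hlim'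
    (Eventually.of_forall fun _ => zero_le) ?_
  filter_upwards [hlog.eventually_gt_atTop 0, hξ.eventually_gt_atTop 0] with n hn hξn
  have hpos : 0 < ξ n U := (div_pos_iff_of_pos_right hn).1 hξn
  let N : Ω → ℕ := fun ω => ∑ t ∈ Finset.Ico C n, if Unsettled (ξ n) ord (fun i k => W i k ω)
    (fun j k u => D j k u ω) μ Δ n t then 1 else 0
  calc P {ω | Over (run (ξ n) ord (fun i k => W i k ω) (fun j k u => D j k u ω) n)}
      ≤ (∫⁻ ω, (N ω : ENNReal) ∂P) / ENNReal.ofReal (ξ n U) := by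
        rw [ENNReal.le_div_iff_mul_le (Or.inl (ENNReal.ofReal_pos.2 hpos).ne')
          (Or.inl ENNReal.ofReal_ne_top), mul_comm,
          ← lintegral_indicator_const (measurableSet_over hW hD (ξ n) n)]
        refine lintegral_mono fun ω => ?_
        rw [Set.indicator_apply]
        split_ifs with h
        · have h2 := threshold_lt_of_over (μ := μ) (Δ := Δ) hU h
          rw [← ENNReal.ofReal_natCast]
          exact ENNReal.ofReal_le_ofReal h2.le
        · exact zero_le
    _ ≤ ENNReal.ofReal (a * Real.log n + b) / ENNReal.ofReal (ξ n U) := by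
        gcongr
        exact hab (ξ n) n
    _ = _ := (ENNReal.ofReal_div_of_pos hpos).symm

/-- A lone user never collides, and a count of zero cannot exceed a nonnegative threshold. -/
lemma estimate_eq_one_of_subsingleton (hU : U = 1) {ξ : ℕ → ℝ} (hξ : 0 ≤ ξ 1)
    (w : Fin C → ℕ → ℕ) (d : Fin U → ℕ → ℕ → ℕ) (n : ℕ) (j : Fin U) :
    (run ξ ord w d n j).estimate = 1 ∧ ∑ i, (run ξ ord w d n j).collisions i = 0 := by
  classical
  induction n with
  | zero => exact ⟨rfl, by simp [run, UserState.start]⟩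
  | succ t ih =>
    by_cases ht : t < C
    · obtain ⟨h1, -, h3, -⟩ := run_of_le ξ ord w d (t := t + 1) ht j
      simp [h1, h3]
    · rw [not_lt] at ht
      have hle := sum_untested_collisions_le (ord := ord) (t := t) (S := run ξ ord w d t)
        (w := fun i => w i (t + 1)) (d := fun j => d j (t + 1)) (j := j)
      rw [ih.2, if_neg] at hle
      · rw [run_succ]
        by_cases hne : (slot ξ ord t (run ξ ord w d t) (fun i => w i (t + 1))
            (fun j => d j (t + 1)) j).estimate = (run ξ ord w d t j).estimate
        · refine ⟨hne.trans ih.1, ?_⟩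
          rw [slot_eq_untested ht hne]
          omega
        · have h1 := (slot_of_estimate_ne ht hne).1
          have h2 := (collisionCount_le (untested ord t (run ξ ord w d t) (fun i => w i (t + 1))
            (fun j => d j (t + 1)) j) (t + 1) (run ξ ord w d t j).estimate).trans hle
          rw [Nat.le_zero.1 h2, ih.1] at h1
          simp at h1
          linarith
      · rintro ⟨k, hk, -⟩
        subst hU
        exact hk (Subsingleton.elim _ _)

end Final

end CognitiveAccess

theorem mainTheorem5
    (U C : ℕ) [NeZero C] (hU : 1 ≤ U) (hUC : U ≤ C)
    -- mean availabilities of the channels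
    (μ : Fin C → ℝ) (hμ : ∀ i, μ i ∈ Set.Ioo (0 : ℝ) 1) (hμ_inj : Function.Injective μ)
    {Ω : Type*} [MeasurableSpace Ω] (P : Measure Ω) [IsProbabilityMeasure P]
    -- `W i k`: availability of channel `i` in slot `k`, Bernoulli with mean `μ i`
    (W : Fin C → ℕ → Ω → ℕ) (hW_meas : ∀ i k, Measurable (W i k))
    (hW_one : ∀ i k, P {ω | W i k ω = 1} = ENNReal.ofReal (μ i))
    (hW_zero : ∀ i k, P {ω | W i k ω = 0} = ENNReal.ofReal (1 - μ i))
    -- `D j k u`: draw of user `j` in slot `k` from the uniform distribution on `{1, …, u}`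
    (D : Fin U → ℕ → ℕ → Ω → ℕ) (hD_meas : ∀ j k u, Measurable (D j k u))
    (hD_unif : ∀ j k u, ∀ r ∈ Finset.Icc 1 u, P {ω | D j k u ω = r} = (u : ENNReal)⁻¹)
    -- all availabilities and all draws are mutually independent
    (h_indep : iIndepFun
      (Sum.elim (fun p : Fin C × ℕ => W p.1 p.2)
        (fun q : Fin U × ℕ × ℕ => D q.1 q.2.1 q.2.2)) P)
    -- the order in which each user senses the channels during initialization
    (ord : Fin U → Equiv.Perm (Fin C))
    -- thresholds `ξ n k` for horizon `n` and estimate `k`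
    (ξ : ℕ → ℕ → ℝ) (hξ_one : ∀ n, 0 ≤ ξ n 1)
    (hξ : ∀ k, 1 < k → Tendsto (fun n : ℕ => ξ n k / Real.log n) atTop atTop) :
    Tendsto
      (fun n : ℕ => P {ω | ∀ j : Fin U,
        (CognitiveAccess.run (ξ n) ord (fun i k => W i k ω) (fun j k u => D j k u ω) n j).estimate
          ≤ U})
      atTop (𝓝 1) := by
  have h01 := CognitiveAccess.ae_availability hW_meas hμ hW_one hW_zero
  have hover : Tendsto (fun n : ℕ => P {ω | CognitiveAccess.Over (CognitiveAccess.run (ξ n) ord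
      (fun i k => W i k ω) (fun j k u => D j k u ω) n)}) atTop (𝓝 0) := by
    -- Growth of the threshold is assumed only for estimates above `1`, so a single user is treated
    -- separately.
    rcases hU.eq_or_lt with hU1 | hU2
    · refine tendsto_const_nhds.congr fun n => ?_
      rw [← measure_empty (μ := P)]
      congr 1
      refine (Set.eq_empty_of_forall_notMem ?_).symm
      rintro ω ⟨j, hj⟩
      rw [(CognitiveAccess.estimate_eq_one_of_subsingleton hU1.symm (hξ_one n) _ _ n j).1] at hj
      omega
    · exact CognitiveAccess.tendsto_measure_over hU2 hUC (fun i => (hμ i).1) hμ_inj hW_meas hD_meas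
        h_indep hW_one h01 hD_unif (hξ U hU2)
  have hsub : Tendsto (fun n : ℕ => 1 - P {ω | CognitiveAccess.Over (CognitiveAccess.run (ξ n) ord
      (fun i k => W i k ω) (fun j k u => D j k u ω) n)}) atTop (𝓝 (1 - 0)) :=
    ENNReal.Tendsto.sub tendsto_const_nhds hover (Or.inl ENNReal.one_ne_top)
  rw [tsub_zero] at hsub
  refine hsub.congr fun n => ?_
  rw [← prob_compl_eq_one_sub (CognitiveAccess.measurableSet_over hW_meas hD_meas (ξ n) n)]
  congr 1
  ext ω
  simp [CognitiveAccess.Over]
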